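/- Let $n,p\ge 0$ be integers, not both zero, and view $M=S^{2n+1}\times S^{2p+1}\subset\mathbb{C}^{n+1}\times\mathbb{C}^{p+1}$ as the homogeneous space $U(n+1)/U(n)\times U(p+1)/U(p)$, with base point $o=(e_0,e_0)$, where $U(n)$ (resp. $U(p)$) is embedded as the stabilizer of $e_0$. Let $E_{\nu\mu}$ ($0\le\mu,\nu\le n$, resp. $p$) be the matrix units, $Z_{\nu\mu}=E_{\nu\mu}-E_{\mu\nu}$ and $T_{\nu\mu}=E_{\nu\mu}+E_{\mu\nu}$. In $\mathfrak{u}(n+1)$ put $X^1=\frac12 iT_{00}$, $Y^1_{2\nu-1}=Z_{\nu0}$, $Y^1_{2\nu}=iT_{\nu0}$ ($1\le\nu\le n$), and in $\mathfrak{u}(p+1)$ put $X^2=\frac12 iT_{00}$, $Y^2_{2\nu-1}=Z_{\nu0}$, $Y^2_{2\nu}=iT_{\nu0}$ ($1\le\nu\le p$). Via $A\mapsto\frac{d}{dt}\big|_{0}\exp(tA)\cdot o$ these vectors are a basis of $T_oM$; they are transported to every point $k\cdot o$ by the differential of the action of $k\in U(n+1)\times U(p+1)$. For real $a$ and $c>0$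 let $g(a,c)(U,V)=\omega(U,I(a,c)V)$ be the $U(n+1)\times U(p+1)$-invariant Riemannian metric on $M$ given by the invariant 2-form $\omega=X^1\wedge X^2+\sum_{\nu=1}^nY^1_{2\nu-1}\wedge Y^1_{2\nu}+\sum_{\nu=1}^pY^2_{2\nu-1}\wedge Y^2_{2\nu}$ (in which the vectors stand for the dual basis) and the invariant complex structure $I(a,c)$ with $I(a,c)X^1=\frac acX^1+\frac1cX^2$, $I(a,c)X^2=-\frac{a^2+c^2}cX^1-\frac acX^2$, $I(a,c)Y^i_{2\nu-1}=Y^i_{2\nu}$. Thus $g(a,c)(X^1,X^1)=\frac1c$, $g(a,c)(X^2,X^2)=\frac{a^2+c^2}c$, $g(a,c)(X^1,X^2)=-\frac ac$, the $Y^i_j$ are orthonormal and they are orthogonal to $X^1,X^2$. Then at every point of $M$: 1. The Ricci tensor of $g(a,c)$ is given in the basis $X^1,X^2,Y^1_j,Y^2_k$ by $$Ric(X^1,X^1)=2\frac{n+pa^2}{c^2}=:x,\qquad Ric(X^2,X^2)=2\frac{na^2+p(a^2+c^2)^2}{c^2}=:y,$$ $$Ric(X^1,X^2)=-2\frac a{c^2}\bigl(n+p(a^2+c^2)\bigr)=:z,$$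 $$Ric(Y^1_j,Y^1_j)=2\Bigl(1+n-\frac1c\Bigr)\ (1\le j\le 2n),\qquad Ric(Y^2_k,Y^2_k)=2\Bigl(1+p-\frac{a^2+c^2}c\Bigr)\ (1\le k\le 2p),$$ and $Ric(X,Y)=0$ for all other pairs of basis vectors. The eigenvalues, with multiplicity, of the symmetric matrix of the Ricci tensor in this basis (that is, of the matrix $(Ric(e_i,e_j))_{i,j}$ of the bilinear form) are $$\tilde r_{1,2}=\frac{x+y\pm\sqrt{(x-y)^2+4z^2}}2,\quad \tilde r_3=\dots=\tilde r_{2n+2}=2\Bigl(1+n-\frac1c\Bigr),\quad \tilde r_{2n+3}=\dots=\tilde r_{2n+2p+2}=2\Bigl(1+p-\frac{a^2+c^2}c\Bigr).$$ 2. The scalar curvature of $g(a,c)$ is $$s=4n\Bigl(1+n-\frac1{2c}\Bigr)+4p\Bigl(1+p-\frac{a^2+c^2}{2c}\Bigr).$$ -/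

import Mathlib

set_option maxSynthPendingDepth 3

open scoped Manifold ContDiff Matrix

noncomputable section

/-! ## Levi-Civita connection and curvature of a metric in a chart

`G : E → E →L[ℝ] E →L[ℝ] ℝ` is a field of symmetric bilinear forms on the model space `E`,
`G y v w = ∑ G_ij(y) v^i w^j`. -/

namespace RiemChart

variable {E : Type*} [NormedAddCommGroup E] [NormedSpace ℝ E]

/-- Christoffel symbols of the first kind:
`christoffelLow G y v w u = (1/2) (∂_v G(w,u) + ∂_w G(v,u) - ∂_u G(v,w))` at `y`. -/
def christoffelLow (G : E → E →L[ℝ] E →L[ℝ] ℝ) (y : E) : E →L[ℝ] E →L[ℝ] (E →L[ℝ] ℝ) :=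
  (1 / 2 : ℝ) • (fderiv ℝ G y + (fderiv ℝ G y).flip -
    (ContinuousLinearMap.flipₗᵢ ℝ E E ℝ).toContinuousLinearEquiv.toContinuousLinearMap.comp
      (fderiv ℝ G y).flip)

theorem christoffelLow_apply (G : E → E →L[ℝ] E →L[ℝ] ℝ) (y v w u : E) :
    christoffelLow G y v w u =
      (1 / 2) * (fderiv ℝ G y v w u + fderiv ℝ G y w v u - fderiv ℝ G y u v w) := by
  simp [christoffelLow]

/-- Christoffel symbols `Γ(v,w) = ∇_v w` (for constant fields `v`, `w`) of the Levi-Civita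
connection: `G y (Γ(v,w)) u = christoffelLow G y v w u` for all `u`. -/
def christoffel (G : E → E →L[ℝ] E →L[ℝ] ℝ) (y : E) : E →L[ℝ] E →L[ℝ] E :=
  (ContinuousLinearMap.compL ℝ E (E →L[ℝ] ℝ) E (G y).inverse).comp (christoffelLow G y)

theorem christoffel_apply (G : E → E →L[ℝ] E →L[ℝ] ℝ) (y v w : E) :
    christoffel G y v w = (G y).inverse (christoffelLow G y v w) := rfl

/-- The curvature `u ↦ R(u,v)w = ∇_u ∇_v w - ∇_v ∇_u w - ∇_[u,v] w` at `y`
(for constant fields `u`, `v`, `w`). -/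
def curvature (G : E → E →L[ℝ] E →L[ℝ] ℝ) (y v w : E) : E →ₗ[ℝ] E where
  toFun u := fderiv ℝ (christoffel G) y u v w - fderiv ℝ (christoffel G) y v u w +
    christoffel G y u (christoffel G y v w) - christoffel G y v (christoffel G y u w)
  map_add' u u' := by simp; abel
  map_smul' r u := by simp [smul_sub, smul_add]

/-- The Ricci form `Ric(v,w) = tr (u ↦ R(u,v)w)` at `y`. -/
def ricciForm (G : E → E →L[ℝ] E →L[ℝ] ℝ) (y : E) : E →ₗ[ℝ] E →ₗ[ℝ] ℝ :=
  LinearMap.mk₂ ℝ (fun v w => LinearMap.trace ℝ E (curvature G y v w))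
    (fun v v' w => by
      rw [← map_add]; congr 1; ext u; simp [curvature]; abel)
    (fun r v w => by
      rw [← map_smul]; congr 1; ext u; simp [curvature, smul_sub, smul_add])
    (fun v w w' => by
      rw [← map_add]; congr 1; ext u; simp [curvature]; abel)
    (fun r v w => by
      rw [← map_smul]; congr 1; ext u; simp [curvature, smul_sub, smul_add])

/-- The Ricci operator at `y`: `G y (ricciOperator G y v) w = ricciForm G y v w`, that is,
`Ric` with one index raised by `G`. -/
def ricciOperator [FiniteDimensional ℝ E] (G : E → E →L[ℝ] E →L[ℝ] ℝ) (y : E) : E →ₗ[ℝ] E :=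
  (G y).inverse.toLinearMap ∘ₗ
    (LinearMap.toContinuousLinearMap : (E →ₗ[ℝ] ℝ) ≃ₗ[ℝ] (E →L[ℝ] ℝ)).toLinearMap ∘ₗ
      ricciForm G y

/-- The scalar curvature at `y`: the trace `G^ij Ric_ij` of the Ricci form with respect to `G`. -/
def scalar [FiniteDimensional ℝ E] (G : E → E →L[ℝ] E →L[ℝ] ℝ) (y : E) : ℝ :=
  LinearMap.trace ℝ E (ricciOperator G y)

end RiemChart

/-! ## Ricci and scalar curvature of a metric on a manifold without boundary -/

namespace RiemManifold

variable {E : Type*} [NormedAddCommGroup E] [NormedSpace ℝ E]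
  {H : Type*} [TopologicalSpace H] (I : ModelWithCorners ℝ E H)
  {M : Type*} [TopologicalSpace M] [ChartedSpace H M]

/-- The pullback `(u, v) ↦ B (D u) (D v)` of a bilinear form `B` by a linear map `D`. -/
def pullbackForm {T F : Type*} [AddCommGroup T] [Module ℝ T] [TopologicalSpace T]
    [AddCommGroup F] [Module ℝ F] [TopologicalSpace F]
    (B : F →L[ℝ] F →L[ℝ] ℝ) (D : T →L[ℝ] F) : T →L[ℝ] T →L[ℝ] ℝ :=
  ((ContinuousLinearMap.precomp ℝ D).comp B).comp D

theorem pullbackForm_apply {T F : Type*} [AddCommGroup T] [Module ℝ T] [TopologicalSpace T]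
    [AddCommGroup F] [Module ℝ F] [TopologicalSpace F]
    (B : F →L[ℝ] F →L[ℝ] ℝ) (D : T →L[ℝ] F) (u v : T) :
    pullbackForm B D u v = B (D u) (D v) := rfl

/-- The pullback of a metric `g` on `M` to the model space by the inverse of the chart at `x`. -/
def metricInChart (g : (x : M) → TangentSpace I x →L[ℝ] TangentSpace I x →L[ℝ] ℝ) (x : M) :
    E → E →L[ℝ] E →L[ℝ] ℝ := fun y =>
  pullbackForm (g ((extChartAt I x).symm y)) (mfderiv 𝓘(ℝ, E) I (extChartAt I x).symm y)

/-- The Ricci curvature `Ric_x(v,w)` of `g`, computed in the chart at `x`. -/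
def ricci (g : (x : M) → TangentSpace I x →L[ℝ] TangentSpace I x →L[ℝ] ℝ) (x : M)
    (v w : TangentSpace I x) : ℝ :=
  RiemChart.ricciForm (metricInChart I g x) (extChartAt I x x)
    (mfderiv I 𝓘(ℝ, E) (extChartAt I x) x v) (mfderiv I 𝓘(ℝ, E) (extChartAt I x) x w)

/-- The scalar curvature of `g` at `x`, computed in the chart at `x`. -/
def scalar [FiniteDimensional ℝ E]
    (g : (x : M) → TangentSpace I x →L[ℝ] TangentSpace I x →L[ℝ] ℝ) (x : M) : ℝ :=
  RiemChart.scalar (metricInChart I g x) (extChartAt I x x)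

end RiemManifold

/-! ## The manifold `S^{2n+1} × S^{2p+1} = U(n+1)/U(n) × U(p+1)/U(p)` -/

namespace SphereProduct

/-- The complex Euclidean space `ℂ^{n+1}`, with coordinates numbered from `0` to `n`. -/
abbrev Cn (n : ℕ) := EuclideanSpace ℂ (Fin (n + 1))

instance finrankCn (n : ℕ) : Fact (Module.finrank ℝ (Cn n) = (2 * n + 1) + 1) :=
  ⟨by
    rw [← Module.finrank_mul_finrank ℝ ℂ (Cn n), Complex.finrank_real_complex,
      finrank_euclideanSpace_fin]
    ring⟩

/-- The unit sphere `S^{2n+1}` of `ℂ^{n+1}`. -/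
abbrev S (n : ℕ) := Metric.sphere (0 : Cn n) 1

/-- The model with corners of the `(2n+1) + (2p+1)`-dimensional manifold
`S^{2n+1} × S^{2p+1}`. -/
abbrev model (n p : ℕ) := (𝓡 (2 * n + 1)).prod (𝓡 (2 * p + 1))

/-- The inclusion of `S^{2n+1} × S^{2p+1}` in `ℂ^{n+1} × ℂ^{p+1}`. -/
def incl (n p : ℕ) (x : S n × S p) : Cn n × Cn p := (x.1, x.2)

/-! ### The homogeneous structure -/

/-- The Lie algebra `𝔲(m)` of `U(m)`: the skew-Hermitian `m × m` matrices. -/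
abbrev LieU (m : ℕ) := skewAdjoint (Matrix (Fin m) (Fin m) ℂ)

theorem exp_mem_unitary {m : ℕ} (A : LieU m) (t : ℝ) :
    NormedSpace.exp (t • (A : Matrix (Fin m) (Fin m) ℂ)) ∈ Matrix.unitaryGroup (Fin m) ℂ := by
  have h : (t • (A : Matrix (Fin m) (Fin m) ℂ))ᴴ = -(t • (A : Matrix (Fin m) (Fin m) ℂ)) := by
    rw [Matrix.conjTranspose_smul, ← Matrix.star_eq_conjTranspose, skewAdjoint.mem_iff.1 A.2]
    simp
  rw [Matrix.mem_unitaryGroup_iff, Matrix.star_eq_conjTranspose, ← Matrix.exp_conjTranspose, h,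
    ← Matrix.exp_add_of_commute _ _
      (Commute.neg_right (Commute.refl (t • (A : Matrix (Fin m) (Fin m) ℂ))))]
  simp

/-- The one-parameter subgroup `t ↦ exp (t A)` of `U(m)`. -/
def expU {m : ℕ} (A : LieU m) (t : ℝ) : Matrix.unitaryGroup (Fin m) ℂ :=
  ⟨NormedSpace.exp (t • (A : Matrix (Fin m) (Fin m) ℂ)), exp_mem_unitary A t⟩

/-- The point `k · e₀` of the sphere `S^{2n+1}`, where `e₀ = (1, 0, …, 0)`, whose stabilizer in
`U(n+1)` is the subgroup `U(n)` of the block matrices `diag(1, M)`. -/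
def orbit {n : ℕ} (k : Matrix.unitaryGroup (Fin (n + 1)) ℂ) : S n :=
  ⟨WithLp.toLp 2 ((k : Matrix (Fin (n + 1)) (Fin (n + 1)) ℂ) *ᵥ Pi.single 0 1), by
    have h := congrFun (congrFun (Matrix.mem_unitaryGroup_iff'.1 k.2) 0) 0
    rw [mem_sphere_zero_iff_norm, EuclideanSpace.norm_eq, Real.sqrt_eq_one]
    simp only [Matrix.mul_apply, Matrix.star_apply, Matrix.one_apply_eq, RCLike.star_def,
      ← Complex.normSq_eq_conj_mul_self] at h
    simp only [Matrix.mulVec_single_one, Matrix.col_apply, Complex.sq_norm]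
    exact_mod_cast h⟩

/-- The Lie group `U(n+1) × U(p+1)`. -/
abbrev G (n p : ℕ) :=
  Matrix.unitaryGroup (Fin (n + 1)) ℂ × Matrix.unitaryGroup (Fin (p + 1)) ℂ

/-- The point `k · o` of `S^{2n+1} × S^{2p+1}`, where `o = (e₀, e₀)`. -/
def point {n p : ℕ} (k : G n p) : S n × S p := (orbit k.1, orbit k.2)

/-- The tangent vector at `k · o` that corresponds to `A ∈ 𝔲(n+1) × 𝔲(p+1)`: the velocity at
`t = 0` of `t ↦ k exp(tA) · o`, that is, the image under the differential of the action of `k` of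
the tangent vector at `o` given by the class of `A` in `𝔤/𝔥`. -/
def tangent {n p : ℕ} (k : G n p) (A : LieU (n + 1) × LieU (p + 1)) :
    TangentSpace (model n p) (point k) :=
  (mfderiv 𝓘(ℝ, ℝ) (model n p) (fun t : ℝ => point (k * (expU A.1 t, expU A.2 t))) 0 :
    ℝ →L[ℝ] EuclideanSpace ℝ (Fin (2 * n + 1)) × EuclideanSpace ℝ (Fin (2 * p + 1))) (1 : ℝ)

/-- `Z_{νμ} = E_{νμ} - E_{μν}`. -/
def Zmat {m : ℕ} (ν μ : Fin m) : Matrix (Fin m) (Fin m) ℂ :=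
  Matrix.single ν μ 1 - Matrix.single μ ν 1

/-- `T_{νμ} = E_{νμ} + E_{μν}`. -/
def Tmat {m : ℕ} (ν μ : Fin m) : Matrix (Fin m) (Fin m) ℂ :=
  Matrix.single ν μ 1 + Matrix.single μ ν 1

theorem Zmat_mem {m : ℕ} (ν μ : Fin m) :
    Zmat ν μ ∈ skewAdjoint (Matrix (Fin m) (Fin m) ℂ) := by
  simp [skewAdjoint.mem_iff, Zmat, Matrix.star_eq_conjTranspose]

theorem I_smul_Tmat_mem {m : ℕ} (ν μ : Fin m) :
    Complex.I • Tmat ν μ ∈ skewAdjoint (Matrix (Fin m) (Fin m) ℂ) := by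
  simp [skewAdjoint.mem_iff, Tmat, Matrix.star_eq_conjTranspose, add_comm,
    ← Matrix.single_neg]

/-- `X = (1/2) i T_{00}`. -/
def Xvec (n : ℕ) : LieU (n + 1) := (1 / 2 : ℝ) • ⟨Complex.I • Tmat 0 0, I_smul_Tmat_mem 0 0⟩

/-- `Yvec n (ν, 0) = Z_{ν0}` and `Yvec n (ν, 1) = i T_{ν0}`; as `ν : Fin n` is counted from `0`,
the row with number `ν + 1` is `ν.succ`. -/
def Yvec (n : ℕ) (j : Fin n × Fin 2) : LieU (n + 1) :=
  if j.2 = 0 then ⟨Zmat j.1.succ 0, Zmat_mem _ _⟩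
  else ⟨Complex.I • Tmat j.1.succ 0, I_smul_Tmat_mem _ _⟩

/-- The indices of the basis `X^1, X^2, Y^1_j, Y^2_k` of `𝔭`, `1 ≤ j ≤ 2n`, `1 ≤ k ≤ 2p`; the
indices `j = 2ν - 1` and `j = 2ν` are represented by the pairs `(ν - 1, 0)` and `(ν - 1, 1)`. -/
abbrev Idx (n p : ℕ) := Fin 2 ⊕ (Fin n × Fin 2) ⊕ (Fin p × Fin 2)

/-- The index of `X^1`. -/
abbrev iX1 {n p : ℕ} : Idx n p := Sum.inl 0

/-- The index of `X^2`. -/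
abbrev iX2 {n p : ℕ} : Idx n p := Sum.inl 1

/-- The index of `Y^1_j`. -/
abbrev iY1 {n p : ℕ} (j : Fin n × Fin 2) : Idx n p := Sum.inr (Sum.inl j)

/-- The index of `Y^2_k`. -/
abbrev iY2 {n p : ℕ} (k : Fin p × Fin 2) : Idx n p := Sum.inr (Sum.inr k)

/-- The basis `X^1, X^2, Y^1_j, Y^2_k` of `𝔭`, in `𝔲(n+1) × 𝔲(p+1)`. -/
def basisVec {n p : ℕ} : Idx n p → LieU (n + 1) × LieU (p + 1)
  | .inl 0 => (Xvec n, 0)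
  | .inl 1 => (0, Xvec p)
  | .inr (.inl j) => (Yvec n j, 0)
  | .inr (.inr k) => (0, Yvec p k)

/-- The invariant frame `X^1, X^2, Y^1_j, Y^2_k`, transported from `o` to the point `k · o`. -/
def frame {n p : ℕ} (k : G n p) (i : Idx n p) : TangentSpace (model n p) (point k) :=
  tangent k (basisVec i)

/-! ### The invariant form `ω`, the complex structures `I(a,c)` and the metrics `g(a,c)`

At a point `(z, w)` a tangent vector `(u, v)` splits into the parts `⟪z, u⟫ z`, `⟪w, v⟫ w` along
the fibres of the Hopf fibrations, which are multiples of `X^1 = i z` and `X^2 = i w`, and the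
horizontal parts, which are spanned by the `Y^1_j` and the `Y^2_k`. -/

/-- The coefficient of `u` at the vertical vector `X = i z`: `Im ⟪z, u⟫`. -/
def vert {n : ℕ} (z : Cn n) : Cn n →L[ℝ] ℝ :=
  Complex.imCLM.comp ((innerSL ℂ z).restrictScalars ℝ)

/-- The horizontal part `u - ⟪z, u⟫ z` of `u`. -/
def horiz {n : ℕ} (z : Cn n) : Cn n →L[ℝ] Cn n :=
  ContinuousLinearMap.id ℝ (Cn n) - (((innerSL ℂ z).smulRight z).restrictScalars ℝ)

/-- Multiplication by `i`. -/
def mulI (n : ℕ) : Cn n →L[ℝ] Cn n := (Complex.I • ContinuousLinearMap.id ℂ (Cn n)).restrictScalars ℝ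

/-- The standard symplectic form `Im ⟪u, u'⟫ = Re ⟪i u, u'⟫` of `ℂ^{n+1}`. -/
def imInner (n : ℕ) : Cn n →L[ℝ] Cn n →L[ℝ] ℝ :=
  (innerSL ℝ : Cn n →L[ℝ] Cn n →L[ℝ] ℝ).comp (mulI n)

theorem imInner_apply (n : ℕ) (u u' : Cn n) : imInner n u u' = (inner ℂ u u').im := by
  have h : imInner n u u' = inner ℝ (Complex.I • u) u' := rfl
  rw [h, PiLp.inner_apply, PiLp.inner_apply, Complex.im_sum]
  refine Finset.sum_congr rfl fun i _ => ?_
  simp [Complex.inner]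
  ring

/-- The coefficient of the tangent vector at `X^1`. -/
def vert1 {n p : ℕ} (x : Cn n × Cn p) : Cn n × Cn p →L[ℝ] ℝ :=
  (vert x.1).comp (ContinuousLinearMap.fst ℝ _ _)

/-- The coefficient of the tangent vector at `X^2`. -/
def vert2 {n p : ℕ} (x : Cn n × Cn p) : Cn n × Cn p →L[ℝ] ℝ :=
  (vert x.2).comp (ContinuousLinearMap.snd ℝ _ _)

/-- The invariant 2-form
`ω = X^1 ∧ X^2 + ∑_ν Y^1_{2ν-1} ∧ Y^1_{2ν} + ∑_ν Y^2_{2ν-1} ∧ Y^2_{2ν}` at `x`. -/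
def omega {n p : ℕ} (x : Cn n × Cn p) : Cn n × Cn p →L[ℝ] Cn n × Cn p →L[ℝ] ℝ :=
  (vert1 x).smulRight (vert2 x) - (vert2 x).smulRight (vert1 x) +
    RiemManifold.pullbackForm (imInner n) ((horiz x.1).comp (ContinuousLinearMap.fst ℝ _ _)) +
    RiemManifold.pullbackForm (imInner p) ((horiz x.2).comp (ContinuousLinearMap.snd ℝ _ _))

/-- The invariant complex structure `I(a,c)` at `x`:
`I X^1 = (a/c) X^1 + (1/c) X^2`, `I X^2 = -((a²+c²)/c) X^1 - (a/c) X^2`, and multiplication by `i`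
on the horizontal parts. -/
def cplx {n p : ℕ} (a c : ℝ) (x : Cn n × Cn p) : Cn n × Cn p →L[ℝ] Cn n × Cn p :=
  ((((a / c) • vert1 x - ((a ^ 2 + c ^ 2) / c) • vert2 x).smulRight (mulI n x.1) +
      ((mulI n).comp (horiz x.1)).comp (ContinuousLinearMap.fst ℝ _ _)).prod
    (((1 / c) • vert1 x - (a / c) • vert2 x).smulRight (mulI p x.2) +
      ((mulI p).comp (horiz x.2)).comp (ContinuousLinearMap.snd ℝ _ _)))

/-- The bilinear form `(U, V) ↦ ω(U, I(a,c) V)` at `x`. -/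
def assocForm {n p : ℕ} (a c : ℝ) (x : Cn n × Cn p) :
    Cn n × Cn p →L[ℝ] Cn n × Cn p →L[ℝ] ℝ :=
  (ContinuousLinearMap.precomp ℝ (cplx a c x)).comp (omega x)

/-- The invariant metric `g(a,c)(U, V) = ω(U, I(a,c) V)` on `S^{2n+1} × S^{2p+1}`. -/
def metric (n p : ℕ) (a c : ℝ) (x : S n × S p) :
    TangentSpace (model n p) x →L[ℝ] TangentSpace (model n p) x →L[ℝ] ℝ :=
  RiemManifold.pullbackForm (assocForm a c (incl n p x)) (mvfderiv (model n p) (incl n p) x)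

/-- The Ricci tensor of `g(a,c)`. -/
def Ric (n p : ℕ) (a c : ℝ) (x : S n × S p) (v w : TangentSpace (model n p) x) : ℝ :=
  RiemManifold.ricci (model n p) (metric n p a c) x v w

/-- The scalar curvature of `g(a,c)`. -/
def scal (n p : ℕ) (a c : ℝ) (x : S n × S p) : ℝ :=
  RiemManifold.scalar (model n p) (metric n p a c) x

/-- The matrix of the Ricci tensor of `g(a,c)` in the basis `X^1, X^2, Y^1_j, Y^2_k` at `k · o`. -/
def ricMatrix {n p : ℕ} (a c : ℝ) (k : G n p) : Matrix (Idx n p) (Idx n p) ℝ :=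
  Matrix.of fun i j => Ric n p a c (point k) (frame k i) (frame k j)

end SphereProduct

end

/-!
The chart of a sphere at a point `x` is the stereographic projection from `-x`; it sends `x` to `0`
and its inverse is `y ↦ (4 y + (4 - |y|²) x) / (4 + |y|²)`, where `y` is real-orthogonal to `x`
(`SphereProduct.coe_extChartAt_symm`). The metric `g(a,c)` is the product of the round metrics plus a
quadratic form with constant coefficients in the two contact forms `Im ⟪z, dz⟫`, `Im ⟪w, dw⟫`, and
both the round metric and the contact form are explicit rational expressions in this chart
(`SphereProduct.isMetric_metricInChart`). So the Ricci tensor at an arbitrary point is the one at the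
origin of an explicit metric on a vector space, and it depends only on the second-order Taylor
expansion of that metric there.

That metric is described by a `HopfModel`: in each factor the Hopf vector `ξ = i x` and the
skew-symmetric operator `j`, the tangential part of the multiplication by `i`, together with the Gram
matrix `α` of the two Hopf vectors, whose determinant is `1`. The curvature with lowered indices is a
combination of the second derivatives of the metric and of products of Christoffel symbols
(`RiemChart.apply_curvature`). At the origin the Christoffel symbols are horizontal
(`HopfModel.IsMetric.christoffel_eq`), so their products are given by the round inner product.
Taking the trace over Euclidean orthonormal bases, with a correction in the plane of the Hopf vectors
(`HopfModel.trace_eq`), gives, with `2 n_i + 1` the dimensions of the factors and `θ_i` the contact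
forms, the Ricci form

  `∑_i 2 (1 + n_i - α_ii) ⟪v_i, w_i⟫_hor + ∑_kl 2 (∑_i n_i α_ik α_il) θ_k(v) θ_l(w)`

(`HopfModel.IsMetric.ricciForm_eq`), and one more trace gives the scalar curvature
(`HopfModel.IsMetric.scalar_eq`).

The invariant frame at `k · o` consists of the vectors `k A e₀`
(`SphereProduct.mvfderiv_incl_tangent`), whose inner products are those of the vectors `A e₀`. In this
frame the Ricci tensor is the sum of a `2 × 2` block and a diagonal matrix
(`SphereProduct.ricMatrix_eq`), which yields the eigenvalues.
-/

noncomputable section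

/-! ### Curvature in a chart in terms of the derivatives of the metric -/

namespace RiemChart

variable {E : Type*} [NormedAddCommGroup E] [NormedSpace ℝ E]

/-- Differentiation commutes with evaluation at fixed vectors. -/
theorem fderiv_apply_apply {G : E → E →L[ℝ] E →L[ℝ] ℝ} {y : E} (hG : DifferentiableAt ℝ G y)
    (t u v : E) : fderiv ℝ G y t u v = fderiv ℝ (fun z => G z u v) y t := by
  have h := ((hG.hasFDerivAt.clm_apply (hasFDerivAt_const u y)).clm_apply
    (hasFDerivAt_const v y)).fderiv
  rw [h]; simp

theorem fderiv_fderiv_apply_apply {G : E → E →L[ℝ] E →L[ℝ] ℝ} (hG : ContDiff ℝ ∞ G)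
    (y s t u v : E) :
    fderiv ℝ (fderiv ℝ G) y s t u v = fderiv ℝ (fderiv ℝ fun z => G z u v) y s t := by
  have hd : Differentiable ℝ G := hG.differentiable (by simp)
  have hd2 : Differentiable ℝ (fderiv ℝ G) :=
    (hG.fderiv_right (m := ∞) (by simp)).differentiable (by simp)
  have hs : ContDiff ℝ ∞ fun z => G z u v :=
    (hG.clm_apply contDiff_const).clm_apply contDiff_const
  have hsd : Differentiable ℝ (fderiv ℝ fun z => G z u v) :=
    (hs.fderiv_right (m := ∞) (by simp)).differentiable (by simp)
  have h1 := ((((hd2 y).hasFDerivAt.clm_apply (hasFDerivAt_const t y)).clm_apply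
    (hasFDerivAt_const u y)).clm_apply (hasFDerivAt_const v y)).fderiv
  have h2 := ((hsd y).hasFDerivAt.clm_apply (hasFDerivAt_const t y)).fderiv
  have h3 : (fun z => fderiv ℝ G z t u v) = fun z => fderiv ℝ (fun z => G z u v) z t :=
    funext fun z => fderiv_apply_apply (hd z) t u v
  rw [h3] at h1
  have := congrArg (fun L : E →L[ℝ] ℝ => L s) (h1.symm.trans h2)
  simpa using this

/-- The defining property of the Christoffel symbols of the second kind. -/
theorem apply_christoffel {G : E → E →L[ℝ] E →L[ℝ] ℝ} {y : E}
    (h : ∃ e : E ≃L[ℝ] (E →L[ℝ] ℝ), (e : E →L[ℝ] (E →L[ℝ] ℝ)) = G y) (v w u : E) :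
    G y (christoffel G y v w) u = christoffelLow G y v w u := by
  obtain ⟨e, he⟩ := h
  rw [christoffel_apply, ← he, ContinuousLinearMap.inverse_equiv]
  simp

variable [FiniteDimensional ℝ E]

theorem contDiff_christoffelLow {G : E → E →L[ℝ] E →L[ℝ] ℝ} (hG : ContDiff ℝ ∞ G) :
    ContDiff ℝ ∞ (christoffelLow G) := by
  have hd : ContDiff ℝ ∞ (fderiv ℝ G) := hG.fderiv_right (by simp)
  refine contDiff_clm_apply_iff.2 fun v => contDiff_clm_apply_iff.2 fun w =>
    contDiff_clm_apply_iff.2 fun u => ?_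
  simp only [christoffelLow_apply]
  have h (a b c : E) : ContDiff ℝ ∞ fun y => fderiv ℝ G y a b c :=
    ((hd.clm_apply contDiff_const).clm_apply contDiff_const).clm_apply contDiff_const
  exact contDiff_const.mul (((h _ _ _).add (h _ _ _)).sub (h _ _ _))

theorem contDiffAt_christoffel {G : E → E →L[ℝ] E →L[ℝ] ℝ} (hG : ContDiff ℝ ∞ G) {y : E}
    (e : E ≃L[ℝ] (E →L[ℝ] ℝ)) (he : G y = e) : ContDiffAt ℝ ∞ (christoffel G) y := by
  have : CompleteSpace E := FiniteDimensional.complete ℝ E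
  have hi : ContDiffAt ℝ ∞ (fun z => (G z).inverse) y := by
    have h := contDiffAt_map_inverse (𝕜 := ℝ) (n := ∞) e
    rw [← he] at h
    exact h.comp y hG.contDiffAt
  exact ((ContinuousLinearMap.compL ℝ E (E →L[ℝ] ℝ) E).contDiff.contDiffAt.comp y hi).clm_comp
    (contDiff_christoffelLow hG).contDiffAt

/-- The derivative of the Christoffel symbols, with its index lowered: differentiate
`apply_christoffel`. -/
theorem apply_fderiv_christoffel {G : E → E →L[ℝ] E →L[ℝ] ℝ} (hG : ContDiff ℝ ∞ G) {y : E}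
    (e : E ≃L[ℝ] (E →L[ℝ] ℝ)) (he : G y = e) (t v w u : E) :
    G y (fderiv ℝ (christoffel G) y t v w) u =
      (1 / 2) * (fderiv ℝ (fderiv ℝ G) y t v w u + fderiv ℝ (fderiv ℝ G) y t w v u -
        fderiv ℝ (fderiv ℝ G) y t u v w) - fderiv ℝ G y t (christoffel G y v w) u := by
  have : CompleteSpace E := FiniteDimensional.complete ℝ E
  have hd2 : DifferentiableAt ℝ (fderiv ℝ G) y :=
    ((hG.fderiv_right (m := ∞) (by simp)).differentiable (by simp)) y
  have hc : DifferentiableAt ℝ (christoffel G) y :=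
    (contDiffAt_christoffel hG e he).differentiableAt (by simp)
  -- The Christoffel symbols are determined by the metric wherever it is invertible, which is an open
  -- condition, so both sides of `apply_christoffel` can be differentiated at `y`.
  have hev : (fun z => G z (christoffel G z v w) u) =ᶠ[nhds y]
      fun z => (1 / 2 : ℝ) * (fderiv ℝ G z v w u + fderiv ℝ G z w v u - fderiv ℝ G z u v w) := by
    have hn := hG.continuous.continuousAt.preimage_mem_nhds
      (show Set.range ((↑) : (E ≃L[ℝ] (E →L[ℝ] ℝ)) → E →L[ℝ] (E →L[ℝ] ℝ)) ∈ nhds (G y) by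
        rw [he]; exact ContinuousLinearEquiv.nhds e)
    filter_upwards [hn] with z hz
    rw [apply_christoffel hz, christoffelLow_apply]
  have hL := ((((hG.differentiable (by simp)) y).hasFDerivAt).clm_apply
    ((hc.hasFDerivAt.clm_apply (hasFDerivAt_const v y)).clm_apply
      (hasFDerivAt_const w y))).clm_apply (hasFDerivAt_const u y)
  have hF (a b c : E) := ((hd2.hasFDerivAt.clm_apply (hasFDerivAt_const a y)).clm_apply
    (hasFDerivAt_const b y)).clm_apply (hasFDerivAt_const c y)
  have hR := (((hF v w u).add (hF w v u)).sub (hF u v w)).const_mul (1 / 2 : ℝ)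
  have := (hL.congr_of_eventuallyEq hev.symm).unique hR
  have := congrArg (fun L : E →L[ℝ] ℝ => L t) this
  simp at this
  linarith

/-- The curvature with all indices lowered, in terms of the second derivatives of the metric and
the Christoffel symbols. -/
theorem apply_curvature {G : E → E →L[ℝ] E →L[ℝ] ℝ} (hG : ContDiff ℝ ∞ G)
    (hs : ∀ y u v, G y u v = G y v u) {y : E}
    (e : E ≃L[ℝ] (E →L[ℝ] ℝ)) (he : G y = e) (v w u t : E) :
    G y (curvature G y v w u) t =
      (1 / 2) * (fderiv ℝ (fderiv ℝ G) y u w v t - fderiv ℝ (fderiv ℝ G) y u t v w -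
        fderiv ℝ (fderiv ℝ G) y v w u t + fderiv ℝ (fderiv ℝ G) y v t u w) -
      G y (christoffel G y u t) (christoffel G y v w) +
      G y (christoffel G y v t) (christoffel G y u w) := by
  have hd := (hG.differentiable (by simp)) y
  have hsymm (a b c d : E) :
      fderiv ℝ (fderiv ℝ G) y a b c d = fderiv ℝ (fderiv ℝ G) y b a c d := by
    have := (hG.contDiffAt (x := y)).isSymmSndFDerivAt
      (by simpa using (ENat.LEInfty.out : (2 : ℕ∞ω) ≤ ∞))
    rw [this a b]
  have hs1 (a b c : E) : fderiv ℝ G y a b c = fderiv ℝ G y a c b := by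
    rw [fderiv_apply_apply hd, fderiv_apply_apply hd]; simp only [hs _ b c]
  have hinv : ∃ e : E ≃L[ℝ] (E →L[ℝ] ℝ), (e : E →L[ℝ] (E →L[ℝ] ℝ)) = G y := ⟨e, he.symm⟩
  have hc (a b c : E) := (apply_christoffel hinv a b c).trans (christoffelLow_apply G y a b c)
  have e1 := apply_fderiv_christoffel hG e he u v w t
  have e2 := apply_fderiv_christoffel hG e he v u w t
  have e3 := hc u (christoffel G y v w) t
  have e4 := hc v (christoffel G y u w) t
  have e5 := hc u t (christoffel G y v w)
  have e6 := hc v t (christoffel G y u w)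
  have e7 := hsymm u v w t
  have e8 := hs1 t u (christoffel G y v w)
  have e9 := hs1 t v (christoffel G y u w)
  have e10 := hs1 u t (christoffel G y v w)
  have e11 := hs1 v t (christoffel G y u w)
  have e12 := hs1 (christoffel G y v w) u t
  have e13 := hs1 (christoffel G y u w) v t
  simp only [curvature, LinearMap.coe_mk, AddHom.coe_mk, map_add, map_sub,
    add_apply, sub_apply]
  linarith

end RiemChart

/-! ### Second-order Taylor expansions -/

/-- The smooth function `f` has the value `c`, the differential `L` and the second derivative `Q`
at the origin. The derivatives are recorded as plain functions, so that they can be given by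
formulas. -/
structure HasTwoJet {E : Type*} [NormedAddCommGroup E] [NormedSpace ℝ E] (f : E → ℝ) (c : ℝ)
    (L : E → ℝ) (Q : E → E → ℝ) : Prop where
  contDiff : ContDiff ℝ ∞ f
  value : f 0 = c
  fst (a : E) : fderiv ℝ f 0 a = L a
  snd (a b : E) : fderiv ℝ (fderiv ℝ f) 0 a b = Q a b

namespace HasTwoJet

variable {E F : Type*} [NormedAddCommGroup E] [NormedSpace ℝ E]
  [NormedAddCommGroup F] [NormedSpace ℝ F]
  {f g : E → ℝ} {c d : ℝ} {L K : E → ℝ} {Q R : E → E → ℝ}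

theorem of_contDiff (hf : ContDiff ℝ ∞ f) :
    HasTwoJet f (f 0) (fderiv ℝ f 0) fun a b => fderiv ℝ (fderiv ℝ f) 0 a b :=
  ⟨hf, rfl, fun _ => rfl, fun _ _ => rfl⟩

theorem congr (h : HasTwoJet f c L Q) (hg : ∀ y, g y = f y) (hc : d = c) (hL : ∀ a, K a = L a)
    (hQ : ∀ a b, R a b = Q a b) : HasTwoJet g d K R := by
  obtain rfl : g = f := funext hg
  obtain rfl : K = L := funext hL
  exact ⟨h.contDiff, h.value.trans hc.symm, h.fst, fun a b => (h.snd a b).trans (hQ a b).symm⟩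

theorem differentiable_fderiv (h : HasTwoJet f c L Q) : Differentiable ℝ (fderiv ℝ f) :=
  (h.contDiff.fderiv_right (m := ∞) (by simp)).differentiable (by simp)

theorem differentiable (h : HasTwoJet f c L Q) : Differentiable ℝ f :=
  h.contDiff.differentiable (by simp)

theorem const (c : ℝ) : HasTwoJet (fun _ : E => c) c (fun _ => 0) fun _ _ => 0 := by
  refine ⟨contDiff_const, rfl, fun a => by simp, fun a b => by simp⟩

theorem clm (ℓ : E →L[ℝ] ℝ) : HasTwoJet ℓ 0 ℓ fun _ _ => 0 := by
  refine ⟨ℓ.contDiff, by simp, fun a => by simp, fun a b => ?_⟩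
  have : fderiv ℝ (ℓ : E → ℝ) = fun _ => ℓ := funext fun y => ℓ.fderiv
  rw [this]; simp

theorem add (hf : HasTwoJet f c L Q) (hg : HasTwoJet g d K R) :
    HasTwoJet (fun y => f y + g y) (c + d) (fun a => L a + K a) fun a b => Q a b + R a b := by
  have h1 : fderiv ℝ (fun y => f y + g y) = fun y => fderiv ℝ f y + fderiv ℝ g y :=
    funext fun y => fderiv_fun_add (hf.differentiable y) (hg.differentiable y)
  refine ⟨hf.contDiff.add hg.contDiff, by rw [hf.value, hg.value], fun a => ?_, fun a b => ?_⟩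
  · rw [h1, ← hf.fst, ← hg.fst]; rfl
  · rw [h1, fderiv_fun_add (hf.differentiable_fderiv 0) (hg.differentiable_fderiv 0),
      ← hf.snd, ← hg.snd]; rfl

theorem mul (hf : HasTwoJet f c L Q) (hg : HasTwoJet g d K R) :
    HasTwoJet (fun y => f y * g y) (c * d) (fun a => c * K a + d * L a)
      fun a b => c * R a b + L a * K b + K a * L b + d * Q a b := by
  have h1 : fderiv ℝ (fun y => f y * g y) = fun y => f y • fderiv ℝ g y + g y • fderiv ℝ f y :=
    funext fun y => fderiv_fun_mul (hf.differentiable y) (hg.differentiable y)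
  refine ⟨hf.contDiff.mul hg.contDiff, by rw [hf.value, hg.value], fun a => ?_, fun a b => ?_⟩
  · rw [h1, ← hf.fst, ← hg.fst, ← hf.value, ← hg.value]; rfl
  · rw [h1]
    have h2 := (((hf.differentiable 0).hasFDerivAt.smul
      (hg.differentiable_fderiv 0).hasFDerivAt).add ((hg.differentiable 0).hasFDerivAt.smul
      (hf.differentiable_fderiv 0).hasFDerivAt)).fderiv
    have h3 := congrArg (fun M : E →L[ℝ] E →L[ℝ] ℝ => M a b) h2
    rw [← hf.snd, ← hg.snd, ← hf.value, ← hg.value, ← hf.fst, ← hf.fst, ← hg.fst, ← hg.fst]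
    refine h3.trans ?_
    simp
    ring

theorem const_mul (r : ℝ) (hf : HasTwoJet f c L Q) :
    HasTwoJet (fun y => r * f y) (r * c) (fun a => r * L a) fun a b => r * Q a b :=
  ((const r).mul hf).congr (fun _ => rfl) rfl (fun a => by ring) fun a b => by ring

/-- The jet of `f⁻¹` is determined by the product rule for `f * f⁻¹ = 1`. -/
theorem inv (hf : HasTwoJet f c L Q) (h0 : ∀ y, f y ≠ 0) :
    HasTwoJet (fun y => (f y)⁻¹) c⁻¹ (fun a => -L a / c ^ 2)
      fun a b => -Q a b / c ^ 2 + 2 * L a * L b / c ^ 3 := by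
  have hi := of_contDiff (f := fun y => (f y)⁻¹) (hf.contDiff.inv h0)
  have hm := hf.mul hi
  have h1 : (fun y => f y * (f y)⁻¹) = fun _ => 1 := funext fun y => mul_inv_cancel₀ (h0 y)
  rw [h1] at hm
  have hc : c ≠ 0 := hf.value ▸ h0 0
  have hfst (a : E) : fderiv ℝ (fun y => (f y)⁻¹) 0 a = -L a / c ^ 2 := by
    have h2 := (hm.fst a).symm.trans ((const (1 : ℝ)).fst a)
    simp only [hf.value] at h2
    field_simp at h2 ⊢
    linarith
  refine ⟨hi.contDiff, by rw [hf.value], hfst, fun a b => ?_⟩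
  have h2 := (hm.snd a b).symm.trans ((const (1 : ℝ)).snd a b)
  simp only [hf.value, hfst] at h2
  field_simp at h2 ⊢
  linarith

theorem comp_clm {f : F → ℝ} {L : F → ℝ} {Q : F → F → ℝ} (hf : HasTwoJet f c L Q)
    (A : E →L[ℝ] F) :
    HasTwoJet (fun y => f (A y)) c (fun a => L (A a)) fun a b => Q (A a) (A b) := by
  have h1 : fderiv ℝ (fun y => f (A y)) = fun y => (fderiv ℝ f (A y)).comp A := funext fun y =>
    ((hf.differentiable (A y)).hasFDerivAt.comp y A.hasFDerivAt).fderiv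
  refine ⟨hf.contDiff.comp A.contDiff, by rw [map_zero, hf.value], fun a => ?_, fun a b => ?_⟩
  · rw [h1, ← hf.fst]; simp
  · rw [h1, ← hf.snd]
    have h2 := (((hf.differentiable_fderiv (A 0)).hasFDerivAt.comp (0 : E) A.hasFDerivAt).clm_comp
      (hasFDerivAt_const A (0 : E))).fderiv
    refine (congrArg (fun M : E →L[ℝ] E →L[ℝ] ℝ => M a b) h2).trans ?_
    simp

theorem norm_sq {V : Type*} [NormedAddCommGroup V] [InnerProductSpace ℝ V] :
    HasTwoJet (fun y : V => ‖y‖ ^ 2) 0 (fun _ => 0) fun a b => 2 * inner ℝ a b := by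
  have h1 : fderiv ℝ (fun y : V => ‖y‖ ^ 2) = (2 : ℝ) • (innerSL ℝ : V →L[ℝ] V →L[ℝ] ℝ) :=
    funext fun y => by
      rw [(hasStrictFDerivAt_norm_sq y).hasFDerivAt.fderiv]; ext; simp
  refine ⟨contDiff_norm_sq ℝ, by simp, fun a => ?_, fun a b => ?_⟩
  · rw [h1]; simp
  · rw [h1]
    have h2 := ((2 : ℝ) • (innerSL ℝ : V →L[ℝ] V →L[ℝ] ℝ)).fderiv (x := 0)
    exact congrArg (fun M : V →L[ℝ] V →L[ℝ] ℝ => M a b) h2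

end HasTwoJet

/-! ### The metric near the origin of the stereographic chart -/

/-- The algebraic identities, at one point of a unit sphere, of the Hopf vector field `ξ` and of the
part `j` of the complex multiplication tangent to the sphere: `j` vanishes on `ξ` and is a
skew-symmetric isometry of the orthogonal complement of `ξ`. -/
structure AlmostContact {V : Type*} [NormedAddCommGroup V] [InnerProductSpace ℝ V] (ξ : V)
    (j : V →L[ℝ] V) : Prop where
  inner_self : inner ℝ ξ ξ = 1
  map_self : j ξ = 0
  skew (u v : V) : inner ℝ (j u) v = -inner ℝ u (j v)
  inner_map (u v : V) : inner ℝ (j u) (j v) = inner ℝ u v - inner ℝ ξ u * inner ℝ ξ v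

theorem AlmostContact.inner_map_right {V : Type*} [NormedAddCommGroup V] [InnerProductSpace ℝ V]
    {ξ : V} {j : V →L[ℝ] V} (h : AlmostContact ξ j) (u : V) : inner ℝ ξ (j u) = 0 := by
  rw [← neg_neg (inner ℝ ξ (j u)), ← h.skew, h.map_self, inner_zero_left, neg_zero]

section Stereographic

variable {V : Type*} [NormedAddCommGroup V] [InnerProductSpace ℝ V]

/-- The factor by which the inverse stereographic projection stretches lengths at `y`. -/
def stereoFactor (y : V) : ℝ := 4 * (4 + ‖y‖ ^ 2)⁻¹

/-- The contact form dual to the Hopf vector field, in the stereographic coordinate `y`. -/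
def stereoContact (ξ : V) (j : V →L[ℝ] V) (y u : V) : ℝ :=
  stereoFactor y ^ 2 * (inner ℝ (j y) u + 1 / 2 * (inner ℝ y u * inner ℝ ξ y) +
    (1 + -1 / 4 * ‖y‖ ^ 2) * inner ℝ ξ u)

/-- The second derivative of `stereoContact ξ j · u` at the origin. -/
def contactHess (ξ a b u : V) : ℝ :=
  1 / 2 * (inner ℝ a u * inner ℝ ξ b + inner ℝ b u * inner ℝ ξ a) -
    3 / 2 * inner ℝ a b * inner ℝ ξ u

theorem hasTwoJet_stereoFactor_sq :
    HasTwoJet (fun y : V => stereoFactor y ^ 2) 1 (fun _ => 0) fun a b => -inner ℝ a b := by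
  have h := (((HasTwoJet.const 4).add (HasTwoJet.norm_sq (V := V))).inv
    (fun y => by positivity)).const_mul 4
  refine (h.mul h).congr (fun y => by rw [stereoFactor, sq]) (by norm_num) (fun a => by simp)
    fun a b => by norm_num; ring

theorem hasTwoJet_stereoContact (ξ : V) (j : V →L[ℝ] V) (u : V) :
    HasTwoJet (fun y => stereoContact ξ j y u) (inner ℝ ξ u) (fun a => inner ℝ (j a) u)
      fun a b => contactHess ξ a b u := by
  have h1 : HasTwoJet (fun y => inner ℝ (j y) u) 0 (fun a => inner ℝ (j a) u) fun _ _ => 0 :=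
    (HasTwoJet.clm ((innerSL ℝ u).comp j)).congr (fun y => real_inner_comm _ _) rfl
      (fun y => real_inner_comm _ _) fun _ _ => rfl
  have h2 : HasTwoJet (fun y => inner ℝ y u) 0 (fun a => inner ℝ a u) fun _ _ => 0 :=
    (HasTwoJet.clm (innerSL ℝ u)).congr (fun y => real_inner_comm _ _) rfl
      (fun y => real_inner_comm _ _) fun _ _ => rfl
  have h3 : HasTwoJet (fun y => inner ℝ ξ y) 0 (fun a => inner ℝ ξ a) fun _ _ => 0 :=
    HasTwoJet.clm (innerSL ℝ ξ)
  have h4 := ((HasTwoJet.const 1).add ((HasTwoJet.norm_sq (V := V)).const_mul (-1 / 4))).mul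
    (HasTwoJet.const (inner ℝ ξ u))
  refine (hasTwoJet_stereoFactor_sq.mul ((h1.add ((h2.mul h3).const_mul (1 / 2))).add h4)).congr
    (fun y => rfl) (by ring) (fun a => by ring) fun a b => ?_
  rw [contactHess]
  ring

end Stereographic

/-- The values at one point of the metric of a product of two odd-dimensional spheres in which the
fibres of the Hopf fibrations are rescaled: the Hopf vectors `ξ`, `η` of the two factors have the
Gram matrix `(α₁, α₁₂; α₁₂, α₂)`, of determinant `1`. -/
structure HopfModel (V W : Type*) [NormedAddCommGroup V] [InnerProductSpace ℝ V]
    [NormedAddCommGroup W] [InnerProductSpace ℝ W] where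
  (ξ : V) (j : V →L[ℝ] V) (η : W) (k : W →L[ℝ] W) (α₁ α₁₂ α₂ : ℝ)
  contact₁ : AlmostContact ξ j
  contact₂ : AlmostContact η k
  det : α₁ * α₂ - α₁₂ ^ 2 = 1

namespace HopfModel

open RiemChart

variable {V W : Type*} [NormedAddCommGroup V] [InnerProductSpace ℝ V]
  [NormedAddCommGroup W] [InnerProductSpace ℝ W] (D : HopfModel V W)

/-- `G` is the metric of the model in the product of the stereographic charts: the product of the
round metrics, changed along the contact forms. -/
def IsMetric (G : V × W → V × W →L[ℝ] V × W →L[ℝ] ℝ) : Prop := ∀ y u v, G y u v =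
  stereoFactor y.1 ^ 2 * inner ℝ u.1 v.1 + stereoFactor y.2 ^ 2 * inner ℝ u.2 v.2 +
  (D.α₁ - 1) * (stereoContact D.ξ D.j y.1 u.1 * stereoContact D.ξ D.j y.1 v.1) +
  D.α₁₂ * (stereoContact D.ξ D.j y.1 u.1 * stereoContact D.η D.k y.2 v.2 +
    stereoContact D.η D.k y.2 u.2 * stereoContact D.ξ D.j y.1 v.1) +
  (D.α₂ - 1) * (stereoContact D.η D.k y.2 u.2 * stereoContact D.η D.k y.2 v.2)

/-- The part along `ξ` by which the metric dual of `u` differs from the Euclidean one. -/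
def lam₁ (u : V × W) : ℝ := (D.α₁ - 1) * inner ℝ D.ξ u.1 + D.α₁₂ * inner ℝ D.η u.2

/-- The part along `η` by which the metric dual of `u` differs from the Euclidean one. -/
def lam₂ (u : V × W) : ℝ := D.α₁₂ * inner ℝ D.ξ u.1 + (D.α₂ - 1) * inner ℝ D.η u.2

/-- The metric at the origin. -/
def form (u v : V × W) : ℝ :=
  inner ℝ u.1 v.1 + inner ℝ u.2 v.2 + D.lam₁ u * inner ℝ D.ξ v.1 + D.lam₂ u * inner ℝ D.η v.2

/-- The first derivative of the metric at the origin. -/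
def formDeriv (a u v : V × W) : ℝ :=
  inner ℝ (D.j a.1) u.1 * D.lam₁ v + inner ℝ (D.j a.1) v.1 * D.lam₁ u +
    inner ℝ (D.k a.2) u.2 * D.lam₂ v + inner ℝ (D.k a.2) v.2 * D.lam₂ u

/-- The second derivative of the metric at the origin. -/
def formHess (a b u v : V × W) : ℝ :=
  -(inner ℝ a.1 b.1 * inner ℝ u.1 v.1) - inner ℝ a.2 b.2 * inner ℝ u.2 v.2 +
  (D.α₁ - 1) * (inner ℝ (D.j a.1) u.1 * inner ℝ (D.j b.1) v.1 +
    inner ℝ (D.j b.1) u.1 * inner ℝ (D.j a.1) v.1) +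
  D.α₁₂ * (inner ℝ (D.j a.1) u.1 * inner ℝ (D.k b.2) v.2 +
    inner ℝ (D.j b.1) u.1 * inner ℝ (D.k a.2) v.2 +
    inner ℝ (D.k a.2) u.2 * inner ℝ (D.j b.1) v.1 +
    inner ℝ (D.k b.2) u.2 * inner ℝ (D.j a.1) v.1) +
  (D.α₂ - 1) * (inner ℝ (D.k a.2) u.2 * inner ℝ (D.k b.2) v.2 +
    inner ℝ (D.k b.2) u.2 * inner ℝ (D.k a.2) v.2) +
  contactHess D.ξ a.1 b.1 u.1 * D.lam₁ v + contactHess D.ξ a.1 b.1 v.1 * D.lam₁ u +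
  contactHess D.η a.2 b.2 u.2 * D.lam₂ v + contactHess D.η a.2 b.2 v.2 * D.lam₂ u

variable {D} {G : V × W → V × W →L[ℝ] V × W →L[ℝ] ℝ}

theorem IsMetric.hasTwoJet (hG : D.IsMetric G) (u v : V × W) :
    HasTwoJet (fun y => G y u v) (D.form u v) (fun a => D.formDeriv a u v)
      fun a b => D.formHess a b u v := by
  have r₁ := (hasTwoJet_stereoFactor_sq (V := V)).comp_clm (ContinuousLinearMap.fst ℝ V W)
  have r₂ := (hasTwoJet_stereoFactor_sq (V := W)).comp_clm (ContinuousLinearMap.snd ℝ V W)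
  have t₁ (u : V × W) := (hasTwoJet_stereoContact D.ξ D.j u.1).comp_clm
    (ContinuousLinearMap.fst ℝ V W)
  have t₂ (u : V × W) := (hasTwoJet_stereoContact D.η D.k u.2).comp_clm
    (ContinuousLinearMap.snd ℝ V W)
  have h := ((((r₁.mul (HasTwoJet.const (inner ℝ u.1 v.1))).add
    (r₂.mul (HasTwoJet.const (inner ℝ u.2 v.2)))).add
    (((t₁ u).mul (t₁ v)).const_mul (D.α₁ - 1))).add
    ((((t₁ u).mul (t₂ v)).add ((t₂ u).mul (t₁ v))).const_mul D.α₁₂)).add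
    (((t₂ u).mul (t₂ v)).const_mul (D.α₂ - 1))
  refine h.congr (fun y => hG y u v) ?_ (fun a => ?_) fun a b => ?_
  · simp only [form, lam₁, lam₂]; ring
  · simp only [formDeriv, lam₁, lam₂, ContinuousLinearMap.coe_fst', ContinuousLinearMap.coe_snd']
    ring
  · simp only [formHess, lam₁, lam₂, ContinuousLinearMap.coe_fst', ContinuousLinearMap.coe_snd']
    ring

variable [FiniteDimensional ℝ V] [FiniteDimensional ℝ W]

theorem IsMetric.contDiff (hG : D.IsMetric G) : ContDiff ℝ ∞ G :=
  contDiff_clm_apply_iff.2 fun u => contDiff_clm_apply_iff.2 fun v => (hG.hasTwoJet u v).contDiff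

omit [FiniteDimensional ℝ V] [FiniteDimensional ℝ W] in
theorem IsMetric.symm (hG : D.IsMetric G) (y u v : V × W) : G y u v = G y v u := by
  rw [hG y u v, hG y v u, real_inner_comm u.1, real_inner_comm u.2]; ring

omit [FiniteDimensional ℝ V] [FiniteDimensional ℝ W] in
theorem IsMetric.apply_zero (hG : D.IsMetric G) (u v : V × W) : G 0 u v = D.form u v :=
  (hG.hasTwoJet u v).value

theorem IsMetric.fderiv_apply (hG : D.IsMetric G) (a u v : V × W) :
    fderiv ℝ G 0 a u v = D.formDeriv a u v := by
  rw [fderiv_apply_apply (hG.contDiff.differentiable (by simp) 0), (hG.hasTwoJet u v).fst]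

theorem IsMetric.fderiv_fderiv_apply (hG : D.IsMetric G) (a b u v : V × W) :
    fderiv ℝ (fderiv ℝ G) 0 a b u v = D.formHess a b u v := by
  rw [fderiv_fderiv_apply_apply hG.contDiff, (hG.hasTwoJet u v).snd]

variable (D) in
/-- The vector representing, with respect to the metric at the origin, the functional `⟪s, ·⟫`.
The inverse of the Gram matrix appears without a denominator because its determinant is `1`. -/
def sharp (s : V × W) : V × W :=
  (s.1 + ((D.α₂ - 1) * inner ℝ D.ξ s.1 - D.α₁₂ * inner ℝ D.η s.2) • D.ξ,
    s.2 + ((D.α₁ - 1) * inner ℝ D.η s.2 - D.α₁₂ * inner ℝ D.ξ s.1) • D.η)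

omit [FiniteDimensional ℝ V] [FiniteDimensional ℝ W] in
theorem form_sharp (u s : V × W) :
    D.form u (D.sharp s) = inner ℝ u.1 s.1 + inner ℝ u.2 s.2 := by
  simp only [form, lam₁, lam₂, sharp, inner_add_right, real_inner_smul_right,
    D.contact₁.inner_self, D.contact₂.inner_self, real_inner_comm D.ξ u.1, real_inner_comm D.η u.2]
  linear_combination
    (inner ℝ D.ξ u.1 * inner ℝ D.ξ s.1 + inner ℝ D.η u.2 * inner ℝ D.η s.2) * D.det

/-- The metric is nondegenerate at the origin, so that its inverse is not a junk value there. -/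
theorem IsMetric.exists_equiv (hG : D.IsMetric G) :
    ∃ e : (V × W) ≃L[ℝ] (V × W →L[ℝ] ℝ), G 0 = e := by
  have hinj : Function.Injective (G 0 : V × W →ₗ[ℝ] (V × W →L[ℝ] ℝ)) := by
    rw [injective_iff_map_eq_zero]
    intro u hu
    have h (s : V × W) : inner ℝ u.1 s.1 + inner ℝ u.2 s.2 = 0 := by
      rw [← form_sharp (D := D), ← hG.apply_zero]
      exact congrArg (fun L : V × W →L[ℝ] ℝ => L (D.sharp s)) hu
    refine Prod.ext (inner_self_eq_zero (𝕜 := ℝ).1 ?_) (inner_self_eq_zero (𝕜 := ℝ).1 ?_)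
    · simpa using h (u.1, 0)
    · simpa using h (0, u.2)
  have hrank : Module.finrank ℝ (V × W) = Module.finrank ℝ (V × W →L[ℝ] ℝ) := by
    rw [← (LinearMap.toContinuousLinearMap : (V × W →ₗ[ℝ] ℝ) ≃ₗ[ℝ] (V × W →L[ℝ] ℝ)).finrank_eq]
    exact Subspace.dual_finrank_eq.symm
  exact ⟨(LinearEquiv.ofInjectiveOfFinrankEq _ hinj hrank).toContinuousLinearEquiv, by ext <;> rfl⟩

/-- The Levi-Civita connection at the origin; its values are orthogonal to the Hopf vectors. -/
theorem IsMetric.christoffel_eq (hG : D.IsMetric G) (v w : V × W) :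
    christoffel G 0 v w =
      (D.lam₁ w • D.j v.1 + D.lam₁ v • D.j w.1, D.lam₂ w • D.k v.2 + D.lam₂ v • D.k w.2) := by
  obtain ⟨e, he⟩ := hG.exists_equiv
  have hinj : Function.Injective (G 0) := by rw [he]; exact e.injective
  refine hinj (ContinuousLinearMap.ext fun u => ?_)
  rw [apply_christoffel ⟨e, he.symm⟩, christoffelLow_apply, hG.fderiv_apply, hG.fderiv_apply,
    hG.fderiv_apply, hG.apply_zero]
  simp only [form, formDeriv, lam₁, lam₂, inner_add_right, inner_add_left,
    real_inner_smul_right, real_inner_smul_left, D.contact₁.inner_map_right,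
    D.contact₂.inner_map_right]
  rw [D.contact₁.skew w.1 v.1, D.contact₂.skew w.2 v.2, D.contact₁.skew u.1 v.1,
    D.contact₁.skew u.1 w.1, D.contact₂.skew u.2 v.2, D.contact₂.skew u.2 w.2,
    real_inner_comm (D.j v.1) u.1, real_inner_comm (D.j w.1) u.1,
    real_inner_comm (D.k v.2) u.2, real_inner_comm (D.k w.2) u.2,
    real_inner_comm (D.j v.1) w.1, real_inner_comm (D.k v.2) w.2]
  ring

end HopfModel

/-! ### Ricci form and scalar curvature of the model -/

namespace AlmostContact

variable {V : Type*} [NormedAddCommGroup V] [InnerProductSpace ℝ V] {ξ : V} {j : V →L[ℝ] V}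

theorem inner_map_self (h : AlmostContact ξ j) (u : V) : inner ℝ (j u) u = 0 := by
  have := h.skew u u
  rw [real_inner_comm] at this
  linarith [real_inner_comm u (j u)]

end AlmostContact

namespace HopfModel

open RiemChart

variable {V W : Type*} [NormedAddCommGroup V] [InnerProductSpace ℝ V]
  [NormedAddCommGroup W] [InnerProductSpace ℝ W] {D : HopfModel V W}
  {G : V × W → V × W →L[ℝ] V × W →L[ℝ] ℝ} [FiniteDimensional ℝ V] [FiniteDimensional ℝ W]

omit [FiniteDimensional ℝ V] [FiniteDimensional ℝ W] in
/-- The trace of an endomorphism `T` computed from the bilinear form `(u, t) ↦ G (T u) t`: the trace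
of the form in Euclidean orthonormal bases, corrected in the plane of the Hopf vectors. -/
theorem trace_eq (T : V × W →ₗ[ℝ] V × W) {ι κ : Type*} [Fintype ι] [Fintype κ]
    (e : OrthonormalBasis ι ℝ V) (f : OrthonormalBasis κ ℝ W) :
    LinearMap.trace ℝ (V × W) T =
      ∑ i, D.form (T (e i, 0)) (e i, 0) + ∑ i, D.form (T (0, f i)) (0, f i) +
      ((D.α₂ - 1) * D.form (T (D.ξ, 0)) (D.ξ, 0) - D.α₁₂ * D.form (T (D.ξ, 0)) (0, D.η) -
        D.α₁₂ * D.form (T (0, D.η)) (D.ξ, 0) + (D.α₁ - 1) * D.form (T (0, D.η)) (0, D.η)) := by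
  classical
  have h1 : LinearMap.trace ℝ (V × W) T =
      ∑ i, inner ℝ (T (e i, 0)).1 (e i) + ∑ i, inner ℝ (T (0, f i)).2 (f i) := by
    rw [LinearMap.trace_eq_matrix_trace ℝ (e.toBasis.prod f.toBasis), Matrix.trace,
      Fintype.sum_sum_type]
    congr 1
    · refine Finset.sum_congr rfl fun i _ => ?_
      simp [LinearMap.toMatrix_apply, e.repr_apply_apply, real_inner_comm]
    · refine Finset.sum_congr rfl fun i _ => ?_
      simp [LinearMap.toMatrix_apply, f.repr_apply_apply, real_inner_comm]
  have hξ : (D.ξ, (0 : W)) = ∑ i, inner ℝ D.ξ (e i) • (e i, (0 : W)) := by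
    refine Prod.ext ?_ ?_
    · simp only [Prod.fst_sum, Prod.smul_fst]
      conv_lhs => rw [← e.sum_repr' D.ξ]
      simp only [real_inner_comm]
    · simp [Prod.snd_sum]
  have hη : ((0 : V), D.η) = ∑ i, inner ℝ D.η (f i) • ((0 : V), f i) := by
    refine Prod.ext ?_ ?_
    · simp [Prod.fst_sum]
    · simp only [Prod.snd_sum, Prod.smul_snd]
      conv_lhs => rw [← f.sum_repr' D.η]
      simp only [real_inner_comm]
  have hform (t : V × W) : ∃ L : V × W →ₗ[ℝ] ℝ, ∀ u, D.form u t = L u := by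
    refine ⟨((innerSL ℝ t.1).comp (ContinuousLinearMap.fst ℝ V W) +
      (innerSL ℝ t.2).comp (ContinuousLinearMap.snd ℝ V W) + (inner ℝ D.ξ t.1) •
      ((D.α₁ - 1) • (innerSL ℝ D.ξ).comp (ContinuousLinearMap.fst ℝ V W) +
      D.α₁₂ • (innerSL ℝ D.η).comp (ContinuousLinearMap.snd ℝ V W)) + (inner ℝ D.η t.2) •
      (D.α₁₂ • (innerSL ℝ D.ξ).comp (ContinuousLinearMap.fst ℝ V W) +
      (D.α₂ - 1) • (innerSL ℝ D.η).comp (ContinuousLinearMap.snd ℝ V W)) :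
      V × W →L[ℝ] ℝ), fun u => ?_⟩
    simp [form, lam₁, lam₂, real_inner_comm]
    ring
  have sξ (t : V × W) :
      ∑ i, inner ℝ D.ξ (e i) * D.form (T (e i, 0)) t = D.form (T (D.ξ, 0)) t := by
    obtain ⟨L, hL⟩ := hform t
    simp only [hL]
    rw [hξ, map_sum, map_sum]
    simp only [map_smul, smul_eq_mul]
  have sη (t : V × W) :
      ∑ i, inner ℝ D.η (f i) * D.form (T (0, f i)) t = D.form (T (0, D.η)) t := by
    obtain ⟨L, hL⟩ := hform t
    simp only [hL]
    rw [hη, map_sum, map_sum]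
    simp only [map_smul, smul_eq_mul]
  have hsharp (u s : V × W) : inner ℝ u.1 s.1 + inner ℝ u.2 s.2 = D.form u s +
      ((D.α₂ - 1) * inner ℝ D.ξ s.1 - D.α₁₂ * inner ℝ D.η s.2) * D.form u (D.ξ, 0) +
      ((D.α₁ - 1) * inner ℝ D.η s.2 - D.α₁₂ * inner ℝ D.ξ s.1) * D.form u (0, D.η) := by
    rw [← form_sharp]
    simp only [form, sharp, inner_add_right, real_inner_smul_right, inner_zero_right]
    ring
  have e1 (i : ι) : inner ℝ (T (e i, 0)).1 (e i) = D.form (T (e i, 0)) (e i, 0) +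
      (D.α₂ - 1) * (inner ℝ D.ξ (e i) * D.form (T (e i, 0)) (D.ξ, 0)) -
      D.α₁₂ * (inner ℝ D.ξ (e i) * D.form (T (e i, 0)) (0, D.η)) := by
    have := hsharp (T (e i, 0)) (e i, 0)
    simp only [inner_zero_right] at this
    linarith
  have e2 (i : κ) : inner ℝ (T (0, f i)).2 (f i) = D.form (T (0, f i)) (0, f i) +
      (D.α₁ - 1) * (inner ℝ D.η (f i) * D.form (T (0, f i)) (0, D.η)) -
      D.α₁₂ * (inner ℝ D.η (f i) * D.form (T (0, f i)) (D.ξ, 0)) := by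
    have := hsharp (T (0, f i)) (0, f i)
    simp only [inner_zero_right] at this
    linarith
  rw [h1]
  simp only [e1, e2, Finset.sum_sub_distrib, Finset.sum_add_distrib, ← Finset.mul_sum, sξ, sη]
  ring

/-- The curvature of the model at the origin, with all indices lowered. -/
theorem IsMetric.form_curvature (hG : D.IsMetric G) (v w u t : V × W) :
    D.form (curvature G 0 v w u) t =
      (1 / 2) * (D.formHess u w v t - D.formHess u t v w - D.formHess v w u t +
        D.formHess v t u w) -
      D.form (D.lam₁ t • D.j u.1 + D.lam₁ u • D.j t.1, D.lam₂ t • D.k u.2 + D.lam₂ u • D.k t.2)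
        (D.lam₁ w • D.j v.1 + D.lam₁ v • D.j w.1, D.lam₂ w • D.k v.2 + D.lam₂ v • D.k w.2) +
      D.form (D.lam₁ t • D.j v.1 + D.lam₁ v • D.j t.1, D.lam₂ t • D.k v.2 + D.lam₂ v • D.k t.2)
        (D.lam₁ w • D.j u.1 + D.lam₁ u • D.j w.1, D.lam₂ w • D.k u.2 + D.lam₂ u • D.k w.2) := by
  obtain ⟨e, he⟩ := hG.exists_equiv
  rw [← hG.apply_zero, apply_curvature hG.contDiff hG.symm e he]
  simp only [hG.fderiv_fderiv_apply, hG.christoffel_eq, hG.apply_zero]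

variable (D) in
/-- The horizontal part of the inner product of the first factor. -/
def hor₁ (v w : V × W) : ℝ := inner ℝ v.1 w.1 - inner ℝ D.ξ v.1 * inner ℝ D.ξ w.1

variable (D) in
/-- The horizontal part of the inner product of the second factor. -/
def hor₂ (v w : V × W) : ℝ := inner ℝ v.2 w.2 - inner ℝ D.η v.2 * inner ℝ D.η w.2

omit [FiniteDimensional ℝ V] [FiniteDimensional ℝ W] in
/-- The Christoffel symbols are horizontal, so that their metric product does not involve the
fibre directions. -/
theorem form_christoffel (u t v w : V × W) :
    D.form (D.lam₁ t • D.j u.1 + D.lam₁ u • D.j t.1, D.lam₂ t • D.k u.2 + D.lam₂ u • D.k t.2)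
        (D.lam₁ w • D.j v.1 + D.lam₁ v • D.j w.1, D.lam₂ w • D.k v.2 + D.lam₂ v • D.k w.2) =
      D.lam₁ t * D.lam₁ w * D.hor₁ u v + D.lam₁ t * D.lam₁ v * D.hor₁ u w +
      D.lam₁ u * D.lam₁ w * D.hor₁ t v + D.lam₁ u * D.lam₁ v * D.hor₁ t w +
      D.lam₂ t * D.lam₂ w * D.hor₂ u v + D.lam₂ t * D.lam₂ v * D.hor₂ u w +
      D.lam₂ u * D.lam₂ w * D.hor₂ t v + D.lam₂ u * D.lam₂ v * D.hor₂ t w := by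
  simp only [form, hor₁, hor₂, inner_add_left, inner_add_right, real_inner_smul_left,
    real_inner_smul_right, D.contact₁.inner_map, D.contact₂.inner_map, D.contact₁.inner_map_right,
    D.contact₂.inner_map_right]
  ring

/-- The diagonal term of the trace at a vector `e` of the first factor, as a sum of products of
inner products with `e`, which can be summed over an orthonormal basis term by term. -/
theorem IsMetric.form_curvature_fst (hG : D.IsMetric G) (v w : V × W) (e : V) :
    D.form (curvature G 0 v w (e, 0)) (e, 0) =
      -(inner ℝ v.1 e * inner ℝ e w.1) + (inner ℝ v.1 w.1 + inner ℝ D.ξ v.1 * D.lam₁ w +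
        inner ℝ D.ξ w.1 * D.lam₁ v + D.lam₁ v * D.lam₁ w) * inner ℝ e e -
      3 * (D.α₁ - 1) * (inner ℝ (D.j v.1) e * inner ℝ e (D.j w.1)) -
      ((D.α₁ - 1) * inner ℝ D.ξ w.1 + D.lam₁ w + (D.α₁ - 1) * D.lam₁ w) *
        (inner ℝ D.ξ e * inner ℝ e v.1) -
      ((D.α₁ - 1) * inner ℝ D.ξ v.1 + D.lam₁ v + (D.α₁ - 1) * D.lam₁ v) *
        (inner ℝ D.ξ e * inner ℝ e w.1) +
      (2 * (D.α₁ - 1) * inner ℝ v.1 w.1 + (D.α₁ - 1) * (D.lam₁ w * inner ℝ D.ξ v.1 +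
        D.lam₁ v * inner ℝ D.ξ w.1) + (D.α₁ - 1) ^ 2 * D.hor₁ v w + D.α₁₂ ^ 2 * D.hor₂ v w -
        D.lam₁ v * D.lam₁ w) * (inner ℝ D.ξ e * inner ℝ e D.ξ) := by
  rw [hG.form_curvature, form_christoffel, form_christoffel]
  have l1 : D.lam₁ (e, 0) = (D.α₁ - 1) * inner ℝ D.ξ e := by simp [lam₁]
  have l2 : D.lam₂ (e, 0) = D.α₁₂ * inner ℝ D.ξ e := by simp [lam₂]
  simp only [formHess, contactHess, hor₁, hor₂, l1, l2, inner_zero_left, inner_zero_right, map_zero,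
    D.contact₁.inner_map_self]
  have c1 := real_inner_comm e v.1
  have c2 := real_inner_comm e w.1
  have c3 := real_inner_comm e D.ξ
  have c4 := real_inner_comm w.1 v.1
  have c5 := real_inner_comm w.2 v.2
  have c6 := D.contact₁.skew e v.1
  have c7 := D.contact₁.skew e w.1
  have c8 := D.contact₁.skew w.1 v.1
  have c9 := real_inner_comm e (D.j v.1)
  have c10 := real_inner_comm e (D.j w.1)
  have c11 := real_inner_comm w.1 (D.j v.1)
  simp only [c1, c2, c3, c4, c5, c6, c7, c8, c9, c10, c11]
  ring

/-- The analogue of `form_curvature_fst` in the second factor. -/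
theorem IsMetric.form_curvature_snd (hG : D.IsMetric G) (v w : V × W) (f : W) :
    D.form (curvature G 0 v w (0, f)) (0, f) =
      -(inner ℝ v.2 f * inner ℝ f w.2) + (inner ℝ v.2 w.2 + inner ℝ D.η v.2 * D.lam₂ w +
        inner ℝ D.η w.2 * D.lam₂ v + D.lam₂ v * D.lam₂ w) * inner ℝ f f -
      3 * (D.α₂ - 1) * (inner ℝ (D.k v.2) f * inner ℝ f (D.k w.2)) -
      ((D.α₂ - 1) * inner ℝ D.η w.2 + D.lam₂ w + (D.α₂ - 1) * D.lam₂ w) *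
        (inner ℝ D.η f * inner ℝ f v.2) -
      ((D.α₂ - 1) * inner ℝ D.η v.2 + D.lam₂ v + (D.α₂ - 1) * D.lam₂ v) *
        (inner ℝ D.η f * inner ℝ f w.2) +
      (2 * (D.α₂ - 1) * inner ℝ v.2 w.2 + (D.α₂ - 1) * (D.lam₂ w * inner ℝ D.η v.2 +
        D.lam₂ v * inner ℝ D.η w.2) + (D.α₂ - 1) ^ 2 * D.hor₂ v w + D.α₁₂ ^ 2 * D.hor₁ v w -
        D.lam₂ v * D.lam₂ w) * (inner ℝ D.η f * inner ℝ f D.η) := by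
  rw [hG.form_curvature, form_christoffel, form_christoffel]
  have l1 : D.lam₂ (0, f) = (D.α₂ - 1) * inner ℝ D.η f := by simp [lam₂]
  have l2 : D.lam₁ (0, f) = D.α₁₂ * inner ℝ D.η f := by simp [lam₁]
  simp only [formHess, contactHess, hor₂, hor₁, l1, l2, inner_zero_left, inner_zero_right, map_zero,
    D.contact₂.inner_map_self]
  have c1 := real_inner_comm f v.2
  have c2 := real_inner_comm f w.2
  have c3 := real_inner_comm f D.η
  have c4 := real_inner_comm w.2 v.2
  have c5 := real_inner_comm w.1 v.1
  have c6 := D.contact₂.skew f v.2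
  have c7 := D.contact₂.skew f w.2
  have c8 := D.contact₂.skew w.2 v.2
  have c9 := real_inner_comm f (D.k v.2)
  have c10 := real_inner_comm f (D.k w.2)
  have c11 := real_inner_comm w.2 (D.k v.2)
  simp only [c1, c2, c3, c4, c5, c6, c7, c8, c9, c10, c11]
  ring

/-- The curvature terms that mix the two Hopf vectors; they enter the trace because the Hopf vectors
are not orthogonal to each other. -/
theorem IsMetric.form_curvature_mixed (hG : D.IsMetric G) (v w : V × W) :
    D.form (curvature G 0 v w (D.ξ, 0)) (0, D.η) =
        D.α₁₂ * (D.α₁ * D.hor₁ v w + D.α₂ * D.hor₂ v w) ∧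
      D.form (curvature G 0 v w (0, D.η)) (D.ξ, 0) =
        D.α₁₂ * (D.α₁ * D.hor₁ v w + D.α₂ * D.hor₂ v w) := by
  have l1 : D.lam₁ (D.ξ, 0) = D.α₁ - 1 := by
    simp only [lam₁, D.contact₁.inner_self, inner_zero_right]; ring
  have l2 : D.lam₂ (D.ξ, 0) = D.α₁₂ := by
    simp only [lam₂, D.contact₁.inner_self, inner_zero_right]; ring
  have l3 : D.lam₁ (0, D.η) = D.α₁₂ := by
    simp only [lam₁, D.contact₂.inner_self, inner_zero_right]; ring
  have l4 : D.lam₂ (0, D.η) = D.α₂ - 1 := by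
    simp only [lam₂, D.contact₂.inner_self, inner_zero_right]; ring
  have c1 := real_inner_comm D.ξ v.1
  have c2 := real_inner_comm D.ξ w.1
  have c3 := real_inner_comm D.η v.2
  have c4 := real_inner_comm D.η w.2
  have c5 := real_inner_comm w.1 v.1
  have c6 := real_inner_comm w.2 v.2
  have c7 (u : V) : inner ℝ (D.j u) D.ξ = 0 := by
    rw [real_inner_comm, D.contact₁.inner_map_right]
  have c8 (u : W) : inner ℝ (D.k u) D.η = 0 := by
    rw [real_inner_comm, D.contact₂.inner_map_right]
  constructor <;>
  · rw [hG.form_curvature, form_christoffel, form_christoffel]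
    simp only [formHess, contactHess, hor₁, hor₂, l1, l2, l3, l4, inner_zero_left,
      inner_zero_right, map_zero, D.contact₁.map_self, D.contact₂.map_self,
      D.contact₁.inner_self, D.contact₂.inner_self, c1, c2, c3, c4, c5, c6, c7, c8]
    ring

variable (D) in
/-- The formula for the Ricci form of the model at the origin. -/
def ricciExplicit (v w : V × W) : ℝ :=
  (Module.finrank ℝ V + 1 - 2 * D.α₁) * D.hor₁ v w +
  (Module.finrank ℝ W + 1 - 2 * D.α₂) * D.hor₂ v w +
  (Module.finrank ℝ V - 1) * ((D.α₁ * inner ℝ D.ξ v.1 + D.α₁₂ * inner ℝ D.η v.2) *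
    (D.α₁ * inner ℝ D.ξ w.1 + D.α₁₂ * inner ℝ D.η w.2)) +
  (Module.finrank ℝ W - 1) * ((D.α₁₂ * inner ℝ D.ξ v.1 + D.α₂ * inner ℝ D.η v.2) *
    (D.α₁₂ * inner ℝ D.ξ w.1 + D.α₂ * inner ℝ D.η w.2))

theorem IsMetric.ricciForm_eq (hG : D.IsMetric G) (v w : V × W) :
    ricciForm G 0 v w = D.ricciExplicit v w := by
  have e := stdOrthonormalBasis ℝ V
  have f := stdOrthonormalBasis ℝ W
  have he : ∑ i, inner ℝ (e i) (e i) = (Module.finrank ℝ V : ℝ) := by simp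
  have hf : ∑ i, inner ℝ (f i) (f i) = (Module.finrank ℝ W : ℝ) := by simp
  have c1 := real_inner_comm D.ξ v.1
  have c3 := real_inner_comm D.η v.2
  have c7 (u : V) : inner ℝ (D.j u) D.ξ = 0 := by
    rw [real_inner_comm, D.contact₁.inner_map_right]
  have c8 (u : W) : inner ℝ (D.k u) D.η = 0 := by
    rw [real_inner_comm, D.contact₂.inner_map_right]
  obtain ⟨m1, m2⟩ := hG.form_curvature_mixed v w
  rw [ricciForm, LinearMap.mk₂_apply, trace_eq (D := D) _ e f, m1, m2]
  simp only [hG.form_curvature_fst, hG.form_curvature_snd, Finset.sum_add_distrib,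
    Finset.sum_sub_distrib, Finset.sum_neg_distrib, ← Finset.mul_sum,
    OrthonormalBasis.sum_inner_mul_inner, he, hf, D.contact₁.inner_self, D.contact₂.inner_self,
    D.contact₁.inner_map, D.contact₂.inner_map, c7, c8, c1, c3]
  simp only [ricciExplicit, hor₁, hor₂, lam₁, lam₂]
  -- The determinant comes in through the correction term of `trace_eq`.
  linear_combination (D.α₁ * (inner ℝ v.1 w.1 - inner ℝ D.ξ v.1 * inner ℝ D.ξ w.1) +
    D.α₂ * (inner ℝ v.2 w.2 - inner ℝ D.η v.2 * inner ℝ D.η w.2)) * D.det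

/-- The scalar curvature of the model at the origin. -/
theorem IsMetric.scalar_eq (hG : D.IsMetric G) :
    scalar G 0 = (Module.finrank ℝ V - 1) * (Module.finrank ℝ V + 1 - D.α₁) +
      (Module.finrank ℝ W - 1) * (Module.finrank ℝ W + 1 - D.α₂) := by
  have e := stdOrthonormalBasis ℝ V
  have f := stdOrthonormalBasis ℝ W
  have hT (u t : V × W) : D.form (ricciOperator G 0 u) t = D.ricciExplicit u t := by
    obtain ⟨E, hE⟩ := hG.exists_equiv
    rw [← hG.ricciForm_eq, ← hG.apply_zero, ricciOperator, hE, ContinuousLinearMap.inverse_equiv]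
    simp
  have he : ∑ i, inner ℝ (e i) (e i) = (Module.finrank ℝ V : ℝ) := by simp
  have hf : ∑ i, inner ℝ (f i) (f i) = (Module.finrank ℝ W : ℝ) := by simp
  have r1 (u : V) : D.ricciExplicit (u, 0) (u, 0) =
      (Module.finrank ℝ V + 1 - 2 * D.α₁) * inner ℝ u u +
      ((Module.finrank ℝ V - 1) * D.α₁ ^ 2 + (Module.finrank ℝ W - 1) * D.α₁₂ ^ 2 -
        (Module.finrank ℝ V + 1 - 2 * D.α₁)) * (inner ℝ D.ξ u * inner ℝ u D.ξ) := by
    simp only [ricciExplicit, hor₁, hor₂, inner_zero_right, real_inner_comm D.ξ u]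
    ring
  have r2 (u : W) : D.ricciExplicit (0, u) (0, u) =
      (Module.finrank ℝ W + 1 - 2 * D.α₂) * inner ℝ u u +
      ((Module.finrank ℝ V - 1) * D.α₁₂ ^ 2 + (Module.finrank ℝ W - 1) * D.α₂ ^ 2 -
        (Module.finrank ℝ W + 1 - 2 * D.α₂)) * (inner ℝ D.η u * inner ℝ u D.η) := by
    simp only [ricciExplicit, hor₁, hor₂, inner_zero_right, real_inner_comm D.η u]
    ring
  rw [scalar, trace_eq (D := D) _ e f]
  simp only [hT, r1, r2, Finset.sum_add_distrib, ← Finset.mul_sum,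
    OrthonormalBasis.sum_inner_mul_inner, he, hf, D.contact₁.inner_self, D.contact₂.inner_self]
  simp only [ricciExplicit, hor₁, hor₂, inner_zero_left, inner_zero_right,
    D.contact₁.inner_self, D.contact₂.inner_self]
  linear_combination ((Module.finrank ℝ V - 1) * D.α₁ + (Module.finrank ℝ W - 1) * D.α₂) * D.det

end HopfModel

/-! ### The Hopf structure of the sphere in the stereographic chart -/

namespace SphereProduct

variable {n p : ℕ}

theorem inner_real_eq_re (u v : Cn n) : inner ℝ u v = (inner ℂ u v).re := by
  rw [PiLp.inner_apply, PiLp.inner_apply, Complex.re_sum]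
  refine Finset.sum_congr rfl fun i _ => ?_
  simp [Complex.inner]

theorem vert_apply (z u : Cn n) : vert z u = (inner ℂ z u).im := rfl

theorem horiz_apply (z u : Cn n) : horiz z u = u - inner ℂ z u • z := rfl

theorem mulI_apply (u : Cn n) : mulI n u = Complex.I • u := rfl

theorem inner_self_sphere (x : S n) : inner ℂ (x : Cn n) (x : Cn n) = 1 := by
  rw [inner_self_eq_norm_sq_to_K, norm_eq_of_mem_sphere]; simp

theorem inner_eq_vert {z u : Cn n} (h : inner ℝ z u = 0) :
    inner ℂ z u = (vert z u : ℂ) * Complex.I := by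
  rw [inner_real_eq_re] at h
  refine Complex.ext ?_ ?_ <;> simp [h, vert_apply]

/-- The inclusion in `ℂ^{n+1}` of the model space of the stereographic chart at `x`, which is
identified with the real orthogonal complement of `x`. -/
def chartIncl (x : S n) : EuclideanSpace ℝ (Fin (2 * n + 1)) →ₗᵢ[ℝ] Cn n :=
  (Submodule.subtypeₗᵢ _).comp (OrthonormalBasis.fromOrthogonalSpanSingleton (𝕜 := ℝ) (2 * n + 1)
    (ne_zero_of_mem_unit_sphere (-x))).repr.symm.toLinearIsometry

theorem inner_chartIncl (x : S n) (u : EuclideanSpace ℝ (Fin (2 * n + 1))) :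
    inner ℝ (x : Cn n) (chartIncl x u) = 0 := by
  have h := Submodule.mem_orthogonal_singleton_iff_inner_right.1
    ((OrthonormalBasis.fromOrthogonalSpanSingleton (𝕜 := ℝ) (2 * n + 1)
    (ne_zero_of_mem_unit_sphere (-x))).repr.symm u).2
  have h' : inner ℝ ((-x : S n) : Cn n) (chartIncl x u) = 0 := h
  rwa [coe_neg_sphere, inner_neg_left, neg_eq_zero] at h'

theorem exists_chartIncl (x : S n) {z : Cn n} (hz : inner ℝ (x : Cn n) z = 0) :
    ∃ u, chartIncl x u = z := by
  have hm : z ∈ (ℝ ∙ ((-x : S n) : Cn n))ᗮ := by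
    rw [Submodule.mem_orthogonal_singleton_iff_inner_right, coe_neg_sphere, inner_neg_left, hz,
      neg_zero]
  refine ⟨(OrthonormalBasis.fromOrthogonalSpanSingleton (𝕜 := ℝ) (2 * n + 1)
    (ne_zero_of_mem_unit_sphere (-x))).repr ⟨z, hm⟩, ?_⟩
  exact congrArg Subtype.val (LinearIsometryEquiv.symm_apply_apply _ _)

/-- The orthogonal projection of `ℂ^{n+1}` to the model space of the chart at `x`. -/
def chartProj (x : S n) : Cn n →L[ℝ] EuclideanSpace ℝ (Fin (2 * n + 1)) :=
  ContinuousLinearMap.adjoint (chartIncl x).toContinuousLinearMap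

theorem inner_chartProj (x : S n) (z : Cn n) (u : EuclideanSpace ℝ (Fin (2 * n + 1))) :
    inner ℝ (chartProj x z) u = inner ℝ z (chartIncl x u) :=
  ContinuousLinearMap.adjoint_inner_left (chartIncl x).toContinuousLinearMap u z

theorem chartIncl_chartProj (x : S n) (z : Cn n) :
    chartIncl x (chartProj x z) = z - inner ℝ (x : Cn n) z • (x : Cn n) := by
  have hx : inner ℝ (x : Cn n) (x : Cn n) = 1 := by
    rw [inner_real_eq_re, inner_self_sphere, Complex.one_re]
  obtain ⟨w, hw⟩ := exists_chartIncl x (z := z - inner ℝ (x : Cn n) z • (x : Cn n)) (by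
    rw [inner_sub_right, real_inner_smul_right, hx, mul_one, sub_self])
  rw [← hw]
  congr 1
  refine ext_inner_right ℝ fun u => ?_
  rw [inner_chartProj, ← (chartIncl x).inner_map_map w u, hw, inner_sub_left,
    real_inner_smul_left, inner_chartIncl, mul_zero, sub_zero]

/-- The Hopf vector `i x`, in the model space of the chart at `x`. -/
def hopfVec (x : S n) : EuclideanSpace ℝ (Fin (2 * n + 1)) := chartProj x (Complex.I • (x : Cn n))

/-- The tangential part of the multiplication by `i`, in the model space of the chart at `x`. -/
def hopfJ (x : S n) :
    EuclideanSpace ℝ (Fin (2 * n + 1)) →L[ℝ] EuclideanSpace ℝ (Fin (2 * n + 1)) :=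
  (chartProj x).comp ((mulI n).comp (chartIncl x).toContinuousLinearMap)

theorem inner_I_smul (u v : Cn n) : inner ℝ (Complex.I • u) v = (inner ℂ u v).im := by
  rw [inner_real_eq_re, inner_smul_left]; simp

theorem inner_hopfVec (x : S n) (u : EuclideanSpace ℝ (Fin (2 * n + 1))) :
    inner ℝ (hopfVec x) u = vert (x : Cn n) (chartIncl x u) := by
  rw [hopfVec, inner_chartProj, inner_I_smul, vert_apply]

theorem inner_hopfJ (x : S n) (u v : EuclideanSpace ℝ (Fin (2 * n + 1))) :
    inner ℝ (hopfJ x u) v = (inner ℂ (chartIncl x u) (chartIncl x v)).im := by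
  rw [← inner_I_smul]
  exact inner_chartProj x _ _

theorem chartIncl_hopfVec (x : S n) : chartIncl x (hopfVec x) = Complex.I • (x : Cn n) := by
  rw [hopfVec, chartIncl_chartProj, real_inner_comm, inner_I_smul, inner_self_sphere]
  simp

theorem chartIncl_hopfJ (x : S n) (u : EuclideanSpace ℝ (Fin (2 * n + 1))) :
    chartIncl x (hopfJ x u) =
      Complex.I • chartIncl x u + inner ℝ (hopfVec x) u • (x : Cn n) := by
  have h : chartIncl x (hopfJ x u) = _ := chartIncl_chartProj x (Complex.I • chartIncl x u)
  rw [h, real_inner_comm, inner_I_smul, inner_hopfVec, vert_apply, ← inner_conj_symm,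
    Complex.conj_im, neg_smul, sub_neg_eq_add]

theorem almostContact_hopf (x : S n) : AlmostContact (hopfVec x) (hopfJ x) where
  inner_self := by
    rw [inner_hopfVec, chartIncl_hopfVec, vert_apply, inner_smul_right, inner_self_sphere]; simp
  map_self := by
    apply (chartIncl x).injective
    rw [chartIncl_hopfJ, inner_hopfVec, chartIncl_hopfVec, vert_apply, inner_smul_right,
      inner_self_sphere, smul_smul]
    simp
  skew u v := by
    rw [inner_hopfJ, real_inner_comm, inner_hopfJ, ← inner_conj_symm, Complex.conj_im]
  inner_map u v := by
    have h (u : EuclideanSpace ℝ (Fin (2 * n + 1))) :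
        inner ℝ (x : Cn n) (Complex.I • chartIncl x u) = -inner ℝ (hopfVec x) u := by
      rw [real_inner_comm, inner_I_smul, inner_hopfVec, vert_apply, ← inner_conj_symm,
        Complex.conj_im]
    have hI : inner ℝ (Complex.I • chartIncl x u) (Complex.I • chartIncl x v) = inner ℝ u v := by
      rw [inner_I_smul, inner_smul_right, ← (chartIncl x).inner_map_map u v, inner_real_eq_re]
      simp
    rw [← (chartIncl x).inner_map_map (hopfJ x u), chartIncl_hopfJ, chartIncl_hopfJ,
      inner_add_left, inner_add_right, inner_add_right, hI]
    simp only [real_inner_smul_left, real_inner_smul_right, h]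
    rw [real_inner_comm (x : Cn n) (Complex.I • chartIncl x u), h, inner_real_eq_re (x : Cn n) x,
      inner_self_sphere, Complex.one_re]
    ring

/-- The algebraic data at the point `x` of the metric `g(a,c)`. -/
def hopfModel (a c : ℝ) (hc : c ≠ 0) (x : S n × S p) :
    HopfModel (EuclideanSpace ℝ (Fin (2 * n + 1))) (EuclideanSpace ℝ (Fin (2 * p + 1))) where
  ξ := hopfVec x.1
  j := hopfJ x.1
  η := hopfVec x.2
  k := hopfJ x.2
  α₁ := 1 / c
  α₁₂ := -(a / c)
  α₂ := (a ^ 2 + c ^ 2) / c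
  contact₁ := almostContact_hopf x.1
  contact₂ := almostContact_hopf x.2
  det := by field_simp; ring

/-- The metric `g(a,c)` on vectors tangent to the product of spheres. -/
theorem assocForm_apply (a c : ℝ) (x : S n × S p) {u v : Cn n × Cn p}
    (hu₁ : inner ℝ (x.1 : Cn n) u.1 = 0) (hu₂ : inner ℝ (x.2 : Cn p) u.2 = 0)
    (hv₁ : inner ℝ (x.1 : Cn n) v.1 = 0) (hv₂ : inner ℝ (x.2 : Cn p) v.2 = 0) :
    assocForm a c (incl n p x) u v = inner ℝ u.1 v.1 + inner ℝ u.2 v.2 +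
      (1 / c - 1) * (vert (x.1 : Cn n) u.1 * vert (x.1 : Cn n) v.1) +
      -(a / c) * (vert (x.1 : Cn n) u.1 * vert (x.2 : Cn p) v.2 +
        vert (x.2 : Cn p) u.2 * vert (x.1 : Cn n) v.1) +
      ((a ^ 2 + c ^ 2) / c - 1) * (vert (x.2 : Cn p) u.2 * vert (x.2 : Cn p) v.2) := by
  have key {m : ℕ} (z : S m) (s : ℝ) {u v : Cn m} (hu : inner ℝ (z : Cn m) u = 0)
      (hv : inner ℝ (z : Cn m) v = 0) :
      vert (z : Cn m) (s • mulI m z + mulI m (horiz (z : Cn m) v)) = s ∧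
      imInner m (horiz (z : Cn m) u)
        (horiz (z : Cn m) (s • mulI m z + mulI m (horiz (z : Cn m) v))) =
        inner ℝ u v - vert (z : Cn m) u * vert (z : Cn m) v := by
    have hz := inner_self_sphere z
    have hh : inner ℂ (z : Cn m) (horiz (z : Cn m) v) = 0 := by
      rw [horiz_apply, inner_sub_right, inner_smul_right, hz, mul_one, sub_self]
    have hw : inner ℂ (z : Cn m) (s • mulI m z + mulI m (horiz (z : Cn m) v)) =
        s * Complex.I := by
      rw [mulI_apply, mulI_apply, inner_add_right, ← Complex.coe_smul, inner_smul_right,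
        inner_smul_right, inner_smul_right, hz, hh]
      simp
    refine ⟨by rw [vert_apply, hw]; simp, ?_⟩
    have hw2 : horiz (z : Cn m) (s • mulI m z + mulI m (horiz (z : Cn m) v)) =
        Complex.I • horiz (z : Cn m) v := by
      rw [horiz_apply, hw, mulI_apply, mulI_apply, mul_smul, ← Complex.coe_smul]
      abel
    have h1 : inner ℂ (horiz (z : Cn m) u) (horiz (z : Cn m) v) =
        inner ℂ u v - vert (z : Cn m) u * vert (z : Cn m) v := by
      rw [horiz_apply z u, inner_sub_left, inner_smul_left, hh, horiz_apply, inner_sub_right,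
        inner_smul_right, ← inner_conj_symm u (z : Cn m), inner_eq_vert hu, inner_eq_vert hv]
      simp only [map_mul, Complex.conj_ofReal, Complex.conj_I]
      linear_combination (vert (z : Cn m) u * vert (z : Cn m) v : ℂ) * Complex.I_sq
    rw [hw2, imInner_apply, inner_smul_right, h1, inner_real_eq_re]
    simp
  have k1 := key x.1 ((a / c) * vert (x.1 : Cn n) v.1 -
    ((a ^ 2 + c ^ 2) / c) * vert (x.2 : Cn p) v.2) hu₁ hv₁
  have k2 := key x.2 ((1 / c) * vert (x.1 : Cn n) v.1 - (a / c) * vert (x.2 : Cn p) v.2) hu₂ hv₂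
  have h : assocForm a c (incl n p x) u v = vert (x.1 : Cn n) u.1 *
      vert (x.2 : Cn p) (((1 / c) * vert (x.1 : Cn n) v.1 - (a / c) * vert (x.2 : Cn p) v.2) •
        mulI p x.2 + mulI p (horiz (x.2 : Cn p) v.2)) -
      vert (x.2 : Cn p) u.2 * vert (x.1 : Cn n) (((a / c) * vert (x.1 : Cn n) v.1 -
        ((a ^ 2 + c ^ 2) / c) * vert (x.2 : Cn p) v.2) • mulI n x.1 +
          mulI n (horiz (x.1 : Cn n) v.1)) +
      imInner n (horiz (x.1 : Cn n) u.1) (horiz (x.1 : Cn n) (((a / c) * vert (x.1 : Cn n) v.1 -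
        ((a ^ 2 + c ^ 2) / c) * vert (x.2 : Cn p) v.2) • mulI n x.1 +
          mulI n (horiz (x.1 : Cn n) v.1))) +
      imInner p (horiz (x.2 : Cn p) u.2) (horiz (x.2 : Cn p) (((1 / c) * vert (x.1 : Cn n) v.1 -
        (a / c) * vert (x.2 : Cn p) v.2) •
        mulI p x.2 + mulI p (horiz (x.2 : Cn p) v.2))) := rfl
  rw [h, k1.1, k1.2, k2.1, k2.2]
  ring

end SphereProduct

/-! ### The metric in the stereographic chart -/

namespace SphereProduct

variable {n p : ℕ}

/-- The inverse of the stereographic chart at `x`, as a map to `ℂ^{n+1}`. -/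
def stereoInv (x : S n) (y : EuclideanSpace ℝ (Fin (2 * n + 1))) : Cn n :=
  stereoFactor y • chartIncl x y + (2 * stereoFactor y - 1) • (x : Cn n)

/-- The derivative of `stereoInv x` at `y`. -/
def stereoInvDeriv (x : S n) (y : EuclideanSpace ℝ (Fin (2 * n + 1))) :
    EuclideanSpace ℝ (Fin (2 * n + 1)) →L[ℝ] Cn n :=
  stereoFactor y • (chartIncl x).toContinuousLinearMap +
    ((-(stereoFactor y ^ 2 / 2)) • innerSL ℝ y).smulRight (chartIncl x y + (2 : ℝ) • (x : Cn n))

theorem stereoFactor_mul {V : Type*} [NormedAddCommGroup V] [InnerProductSpace ℝ V] (y : V) :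
    stereoFactor y * (4 + ‖y‖ ^ 2) = 4 := by
  have : (4 + ‖y‖ ^ 2) ≠ 0 := by positivity
  rw [stereoFactor]; field_simp

theorem hasFDerivAt_stereoFactor {V : Type*} [NormedAddCommGroup V] [InnerProductSpace ℝ V]
    (y : V) : HasFDerivAt stereoFactor ((-(stereoFactor y ^ 2 / 2)) • innerSL ℝ y) y := by
  have h0 : (4 + ‖y‖ ^ 2) ≠ 0 := by positivity
  have h := ((hasDerivAt_inv h0).comp_hasFDerivAt y
    ((hasStrictFDerivAt_norm_sq y).hasFDerivAt.const_add 4)).const_mul 4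
  refine h.congr_fderiv (ContinuousLinearMap.ext fun u => ?_)
  simp [stereoFactor]
  field_simp
  ring

theorem hasFDerivAt_stereoInv (x : S n) (y : EuclideanSpace ℝ (Fin (2 * n + 1))) :
    HasFDerivAt (stereoInv x) (stereoInvDeriv x y) y := by
  have h := (hasFDerivAt_stereoFactor y).smul (chartIncl x).toContinuousLinearMap.hasFDerivAt
  have h2 := (((hasFDerivAt_stereoFactor y).const_mul 2).sub_const 1).smul_const (x : Cn n)
  refine (h.add h2).congr_fderiv (ContinuousLinearMap.ext fun u => ?_)
  simp [stereoInvDeriv]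
  module

theorem coe_extChartAt_symm (x : S n) (y : EuclideanSpace ℝ (Fin (2 * n + 1))) :
    (((extChartAt (𝓡 (2 * n + 1)) x).symm y : S n) : Cn n) = stereoInv x y := by
  have h : (((extChartAt (𝓡 (2 * n + 1)) x).symm y : S n) : Cn n) =
      (‖chartIncl x y‖ ^ 2 + 4)⁻¹ • (4 : ℝ) • chartIncl x y +
        (‖chartIncl x y‖ ^ 2 + 4)⁻¹ • (‖chartIncl x y‖ ^ 2 - 4) • ((-x : S n) : Cn n) :=
    stereographic'_symm_apply (-x) y
  have h0 : (4 + ‖y‖ ^ 2) ≠ 0 := by positivity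
  rw [h, LinearIsometry.norm_map, coe_neg_sphere, stereoInv, stereoFactor, smul_smul, smul_smul,
    smul_neg, ← neg_smul, add_comm (‖y‖ ^ 2) 4]
  congr 2
  · ring
  · field_simp
    ring

theorem extChartAt_target_sphere (x : S n) :
    (extChartAt (𝓡 (2 * n + 1)) x).target = Set.univ := by
  have : (chartAt (EuclideanSpace ℝ (Fin (2 * n + 1))) x).target = Set.univ :=
    stereographic'_target (-x)
  simp [this]

/-- The chart at a point of the sphere is centred at this point. -/
theorem extChartAt_sphere_self (x : S n) : extChartAt (𝓡 (2 * n + 1)) x x = 0 := by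
  have h := coe_extChartAt_symm x 0
  have h1 : stereoInv x 0 = (x : Cn n) := by
    simp [stereoInv, stereoFactor]; norm_num
  have h2 : (extChartAt (𝓡 (2 * n + 1)) x).symm 0 = x := Subtype.ext (h.trans h1)
  have h3 := (extChartAt (𝓡 (2 * n + 1)) x).right_inv
    (x := 0) (by rw [extChartAt_target_sphere]; trivial)
  rwa [h2] at h3

section inner

variable (x : S n) (y u v : EuclideanSpace ℝ (Fin (2 * n + 1)))

theorem inner_complex_chartIncl : inner ℂ (x : Cn n) (chartIncl x u) =
    (inner ℝ (hopfVec x) u : ℂ) * Complex.I := by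
  rw [inner_eq_vert (inner_chartIncl x u), inner_hopfVec]

theorem inner_chartIncl_complex : inner ℂ (chartIncl x u) (x : Cn n) =
    -((inner ℝ (hopfVec x) u : ℂ) * Complex.I) := by
  rw [← inner_conj_symm, inner_complex_chartIncl]; simp

theorem stereoInvDeriv_apply : stereoInvDeriv x y u = stereoFactor y • chartIncl x u +
    (-(stereoFactor y ^ 2 / 2) * inner ℝ y u) • (chartIncl x y + (2 : ℝ) • (x : Cn n)) := rfl

theorem inner_complex_chartIncl_chartIncl : inner ℂ (chartIncl x u) (chartIncl x v) =
    (inner ℝ u v : ℂ) + (inner ℝ (hopfJ x u) v : ℂ) * Complex.I := by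
  refine Complex.ext ?_ ?_
  · rw [← inner_real_eq_re, LinearIsometry.inner_map_map]; simp
  · rw [inner_hopfJ]; simp

/-- The inverse chart stays on the unit sphere, so this inner product is imaginary; its imaginary part
is the contact form. -/
theorem inner_stereoInv_deriv : inner ℂ (stereoInv x y) (stereoInvDeriv x y u) =
    (stereoContact (hopfVec x) (hopfJ x) y u : ℂ) * Complex.I := by
  have hs : (stereoFactor y : ℂ) * (4 + (‖y‖ : ℂ) ^ 2) = 4 := mod_cast stereoFactor_mul y
  rw [stereoInv, stereoInvDeriv_apply]
  simp only [← Complex.coe_smul, inner_add_left, inner_add_right, inner_smul_left,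
    inner_smul_right, inner_complex_chartIncl, inner_chartIncl_complex,
    inner_complex_chartIncl_chartIncl, inner_self_sphere, Complex.conj_ofReal,
    real_inner_self_eq_norm_sq,
    (almostContact_hopf x).inner_map_self, stereoContact]
  push_cast
  linear_combination (-(1 / 2) * (stereoFactor y : ℂ) ^ 2 * (inner ℝ y u : ℂ) +
    (stereoFactor y : ℂ) / 4 * (inner ℝ (hopfVec x) u : ℂ) * Complex.I) * hs

/-- Stereographic projection is conformal. -/
theorem inner_stereoInvDeriv : inner ℝ (stereoInvDeriv x y u) (stereoInvDeriv x y v) =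
    stereoFactor y ^ 2 * inner ℝ u v := by
  have hs := stereoFactor_mul y
  have hx : inner ℝ (x : Cn n) (x : Cn n) = 1 := by
    rw [inner_real_eq_re, inner_self_sphere, Complex.one_re]
  have h (u) : inner ℝ (chartIncl x u) (x : Cn n) = 0 := by
    rw [real_inner_comm, inner_chartIncl]
  rw [stereoInvDeriv_apply, stereoInvDeriv_apply]
  simp only [inner_add_left, inner_add_right, real_inner_smul_left, real_inner_smul_right,
    inner_chartIncl, h, hx, LinearIsometry.inner_map_map, real_inner_self_eq_norm_sq,
    real_inner_comm y u]
  linear_combination (stereoFactor y ^ 3 / 4 * inner ℝ y u * inner ℝ y v) * hs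

end inner

theorem mdifferentiable_incl : MDifferentiable (model n p) 𝓘(ℝ, Cn n × Cn p) (incl n p) := by
  have h1 : ContMDiff (model n p) 𝓘(ℝ, Cn n) 1 fun x : S n × S p => (x.1 : Cn n) :=
    (contMDiff_coe_sphere (n := 2 * n + 1)).comp contMDiff_fst
  have h2 : ContMDiff (model n p) 𝓘(ℝ, Cn p) 1 fun x : S n × S p => (x.2 : Cn p) :=
    (contMDiff_coe_sphere (n := 2 * p + 1)).comp contMDiff_snd
  exact (h1.prodMk_space h2).mdifferentiable one_ne_zero

theorem extChartAt_product_target (x : S n × S p) :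
    (extChartAt (model n p) x).target = Set.univ := by
  rw [extChartAt_prod, PartialEquiv.prod_target, extChartAt_target_sphere,
    extChartAt_target_sphere, Set.univ_prod_univ]

theorem extChartAt_product_self (x : S n × S p) : extChartAt (model n p) x x = 0 := by
  rw [extChartAt_prod]
  exact Prod.ext (extChartAt_sphere_self x.1) (extChartAt_sphere_self x.2)

theorem incl_extChartAt_symm (x : S n × S p)
    (y : EuclideanSpace ℝ (Fin (2 * n + 1)) × EuclideanSpace ℝ (Fin (2 * p + 1))) :
    incl n p ((extChartAt (model n p) x).symm y) = (stereoInv x.1 y.1, stereoInv x.2 y.2) := by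
  rw [extChartAt_prod]
  exact Prod.ext (coe_extChartAt_symm x.1 y.1) (coe_extChartAt_symm x.2 y.2)

theorem mdifferentiable_extChartAt_symm (x : S n × S p) :
    MDifferentiable 𝓘(ℝ, EuclideanSpace ℝ (Fin (2 * n + 1)) × EuclideanSpace ℝ (Fin (2 * p + 1)))
      (model n p) (extChartAt (model n p) x).symm := fun y => by
  have h := mdifferentiableWithinAt_extChartAt_symm (I := model n p) (x := x) (z := y)
    (by rw [extChartAt_product_target]; trivial)
  rwa [ModelWithCorners.range_eq_univ, mdifferentiableWithinAt_univ] at h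

theorem mvfderiv_incl_mfderiv_symm (x : S n × S p)
    (y u : EuclideanSpace ℝ (Fin (2 * n + 1)) × EuclideanSpace ℝ (Fin (2 * p + 1))) :
    mvfderiv (model n p) (incl n p) ((extChartAt (model n p) x).symm y)
      (mfderiv 𝓘(ℝ, EuclideanSpace ℝ (Fin (2 * n + 1)) × EuclideanSpace ℝ (Fin (2 * p + 1)))
        (model n p) (extChartAt (model n p) x).symm y u) =
      (stereoInvDeriv x.1 y.1 u.1, stereoInvDeriv x.2 y.2 u.2) := by
  have h1 := mfderiv_comp y (mdifferentiable_incl ((extChartAt (model n p) x).symm y))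
    (mdifferentiable_extChartAt_symm x y)
  have h2 : HasFDerivAt (incl n p ∘ (extChartAt (model n p) x).symm)
      (((stereoInvDeriv x.1 y.1).comp (ContinuousLinearMap.fst ℝ _ _)).prod
        ((stereoInvDeriv x.2 y.2).comp (ContinuousLinearMap.snd ℝ _ _))) y := by
    have : incl n p ∘ (extChartAt (model n p) x).symm =
        fun y => (stereoInv x.1 y.1, stereoInv x.2 y.2) := funext (incl_extChartAt_symm x)
    rw [this]
    exact ((hasFDerivAt_stereoInv x.1 y.1).comp y hasFDerivAt_fst).prodMk
      ((hasFDerivAt_stereoInv x.2 y.2).comp y hasFDerivAt_snd)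
  rw [mfderiv_eq_fderiv, h2.fderiv] at h1
  exact (congrArg (fun L => L u) h1).symm

/-- In the product of the stereographic charts, `g(a,c)` is the metric of `hopfModel`. -/
theorem isMetric_metricInChart (a c : ℝ) (hc : c ≠ 0) (x : S n × S p) :
    (hopfModel a c hc x).IsMetric
      (RiemManifold.metricInChart (model n p) (metric n p a c) x) := by
  intro y u v
  have hE : RiemManifold.metricInChart (model n p) (metric n p a c) x y u v =
      assocForm a c (incl n p ((extChartAt (model n p) x).symm y))
        (mvfderiv (model n p) (incl n p) ((extChartAt (model n p) x).symm y)
          (mfderiv 𝓘(ℝ, EuclideanSpace ℝ (Fin (2 * n + 1)) × EuclideanSpace ℝ (Fin (2 * p + 1)))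
          (model n p) (extChartAt (model n p) x).symm y u))
        (mvfderiv (model n p) (incl n p) ((extChartAt (model n p) x).symm y)
          (mfderiv 𝓘(ℝ, EuclideanSpace ℝ (Fin (2 * n + 1)) × EuclideanSpace ℝ (Fin (2 * p + 1)))
          (model n p) (extChartAt (model n p) x).symm y v)) := rfl
  have e1 : (((extChartAt (model n p) x).symm y).1 : Cn n) = stereoInv x.1 y.1 :=
    congrArg Prod.fst (incl_extChartAt_symm x y)
  have e2 : (((extChartAt (model n p) x).symm y).2 : Cn p) = stereoInv x.2 y.2 :=
    congrArg Prod.snd (incl_extChartAt_symm x y)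
  have hre {m : ℕ} (z : S m) (y u : EuclideanSpace ℝ (Fin (2 * m + 1))) :
      inner ℝ (stereoInv z y) (stereoInvDeriv z y u) = 0 := by
    rw [inner_real_eq_re, inner_stereoInv_deriv]; simp
  have hvert {m : ℕ} (z : S m) (y u : EuclideanSpace ℝ (Fin (2 * m + 1))) :
      vert (stereoInv z y) (stereoInvDeriv z y u) =
        stereoContact (hopfVec z) (hopfJ z) y u := by
    rw [vert_apply, inner_stereoInv_deriv]; simp
  rw [hE, mvfderiv_incl_mfderiv_symm, mvfderiv_incl_mfderiv_symm, assocForm_apply, e1, e2]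
  · simp only [hvert, inner_stereoInvDeriv, hopfModel]
  all_goals simp only [e1, e2, hre]

/-- The coordinates of a tangent vector in the chart at its base point. -/
def chartVec (x : S n × S p) (v : TangentSpace (model n p) x) :
    EuclideanSpace ℝ (Fin (2 * n + 1)) × EuclideanSpace ℝ (Fin (2 * p + 1)) :=
  mfderiv (model n p) 𝓘(ℝ, EuclideanSpace ℝ (Fin (2 * n + 1)) ×
    EuclideanSpace ℝ (Fin (2 * p + 1))) (extChartAt (model n p) x) x v

/-- The Ricci tensor of `g(a,c)` at an arbitrary point, by the formula of the model. -/
theorem Ric_eq (a c : ℝ) (hc : c ≠ 0) (x : S n × S p) (v w : TangentSpace (model n p) x) :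
    Ric n p a c x v w =
      (hopfModel a c hc x).ricciExplicit (chartVec x v) (chartVec x w) := by
  have h := (isMetric_metricInChart a c hc x).ricciForm_eq (chartVec x v) (chartVec x w)
  rw [← extChartAt_product_self x] at h
  exact h

/-- The scalar curvature of `g(a,c)` at an arbitrary point. -/
theorem scal_eq (a c : ℝ) (hc : c ≠ 0) (x : S n × S p) :
    scal n p a c x =
      4 * n * (1 + n - 1 / (2 * c)) + 4 * p * (1 + p - (a ^ 2 + c ^ 2) / (2 * c)) := by
  have h := (isMetric_metricInChart a c hc x).scalar_eq
  rw [← extChartAt_product_self x] at h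
  refine Eq.trans h ?_
  simp only [finrank_euclideanSpace, Fintype.card_fin, hopfModel]
  push_cast
  field_simp
  ring

end SphereProduct

/-! ### The invariant frame -/

namespace SphereProduct

variable {n p : ℕ}

/-- The first column `A e₀` of a matrix. -/
def firstCol {n : ℕ} (A : Matrix (Fin (n + 1)) (Fin (n + 1)) ℂ) : Cn n :=
  WithLp.toLp 2 (A *ᵥ Pi.single 0 1)

theorem firstCol_apply (A : Matrix (Fin (n + 1)) (Fin (n + 1)) ℂ) (i : Fin (n + 1)) :
    firstCol A i = A i 0 := by
  simp [firstCol]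

/-- The linear map `A ↦ k A e₀`. -/
def firstColMul (k : Matrix (Fin (n + 1)) (Fin (n + 1)) ℂ) :
    Matrix (Fin (n + 1)) (Fin (n + 1)) ℂ →ₗ[ℝ] Cn n where
  toFun A := firstCol (k * A)
  map_add' A B := by ext i; simp [firstCol_apply, Matrix.mul_add]
  map_smul' r A := by ext i; simp [firstCol_apply]

/-- Unitary matrices preserve the inner products of the vectors `A e₀`. -/
theorem inner_firstCol_mul (k : Matrix.unitaryGroup (Fin (n + 1)) ℂ)
    (A B : Matrix (Fin (n + 1)) (Fin (n + 1)) ℂ) :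
    inner ℂ (firstCol (k.1 * A)) (firstCol (k.1 * B)) =
      inner ℂ (firstCol A) (firstCol B) := by
  have h (A B : Matrix (Fin (n + 1)) (Fin (n + 1)) ℂ) :
      inner ℂ (firstCol A) (firstCol B) = (Aᴴ * B) 0 0 := by
    rw [PiLp.inner_apply, Matrix.mul_apply]
    refine Finset.sum_congr rfl fun i _ => ?_
    simp [firstCol_apply, mul_comm]
  have hk : k.1ᴴ * k.1 = 1 := Matrix.mem_unitaryGroup_iff'.1 k.2
  rw [h, h]
  rw [Matrix.conjTranspose_mul, Matrix.mul_assoc, ← Matrix.mul_assoc k.1ᴴ, hk, Matrix.one_mul]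

section curve

-- Any norm on matrices that makes them a normed algebra serves to differentiate `exp`.
attribute [local instance] Matrix.linftyOpNormedRing Matrix.linftyOpNormedAlgebra

theorem contDiff_firstColMul_exp (k A : Matrix (Fin (n + 1)) (Fin (n + 1)) ℂ) :
    ContDiff ℝ 1 fun t : ℝ => firstColMul k (NormedSpace.exp (t • A)) := by
  have h1 : ContDiff ℝ 1 (NormedSpace.exp : Matrix (Fin (n + 1)) (Fin (n + 1)) ℂ → _) :=
    contDiff_iff_contDiffAt.2 fun x => (NormedSpace.exp_analytic (𝕂 := ℝ) x).contDiffAt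
  exact (firstColMul k).toContinuousLinearMap.contDiff.comp
    (h1.comp (contDiff_id.smul contDiff_const))

theorem hasDerivAt_firstColMul_exp (k A : Matrix (Fin (n + 1)) (Fin (n + 1)) ℂ) :
    HasDerivAt (fun t : ℝ => firstColMul k (NormedSpace.exp (t • A))) (firstColMul k A) 0 := by
  have h := (firstColMul k).toContinuousLinearMap.hasFDerivAt.comp_hasDerivAt (0 : ℝ)
    (hasDerivAt_exp_smul_const (𝕂 := ℝ) A (0 : ℝ))
  exact h.congr_deriv (by simp; rfl)

end curve

theorem contMDiff_orbit (k : Matrix.unitaryGroup (Fin (n + 1)) ℂ) (A : LieU (n + 1)) :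
    ContMDiff 𝓘(ℝ, ℝ) (𝓡 (2 * n + 1)) 1 fun t : ℝ => orbit (k * expU A t) := by
  have hcoe (t : ℝ) : firstColMul k.1 (NormedSpace.exp (t • A.1)) = (orbit (k * expU A t) : Cn n) :=
    rfl
  have h := ContMDiff.codRestrict_sphere (n := 2 * n + 1)
    (contDiff_firstColMul_exp k.1 A.1).contMDiff fun t => by
      rw [hcoe]; exact (orbit (k * expU A t)).2
  exact h

/-- As a vector of the ambient space, the tangent vector at `k · o` given by `A` is `k A e₀`. -/
theorem mvfderiv_incl_tangent (k : G n p) (A : LieU (n + 1) × LieU (p + 1)) :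
    mvfderiv (model n p) (incl n p) (point k) (tangent k A) =
      (firstCol (k.1.1 * A.1.1), firstCol (k.2.1 * A.2.1)) := by
  have hk : point (k * (expU A.1 0, expU A.2 0)) = point k := by
    have h (m : ℕ) (B : LieU m) : expU B 0 = 1 := Subtype.ext (by simp [expU])
    rw [h, h]
    exact congrArg point (mul_one k)
  have hc : MDifferentiableAt 𝓘(ℝ, ℝ) (model n p)
      (fun t : ℝ => point (k * (expU A.1 t, expU A.2 t))) 0 :=
    ((contMDiff_orbit k.1 A.1).prodMk (contMDiff_orbit k.2 A.2)).mdifferentiable one_ne_zero 0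
  have h := mfderiv_comp_apply_of_eq (0 : ℝ) (mdifferentiable_incl (point k)) hc hk
  have h2 : HasFDerivAt (incl n p ∘ fun t : ℝ => point (k * (expU A.1 t, expU A.2 t))) _ 0 :=
    ((hasDerivAt_firstColMul_exp k.1.1 A.1.1).prodMk
      (hasDerivAt_firstColMul_exp k.2.1 A.2.1)).hasFDerivAt
  have h3 := h (1 : ℝ)
  rw [mfderiv_eq_fderiv, h2.fderiv] at h3
  exact h3.symm.trans (one_smul ℝ _)

/-- The coordinates of a tangent vector at the centre of the chart are its components in the orthogonal
complement of the base point, as the derivative of the inverse chart at `0` is the inclusion. -/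
theorem mvfderiv_incl_eq (x : S n × S p) (v : TangentSpace (model n p) x) :
    mvfderiv (model n p) (incl n p) x v =
      (chartIncl x.1 (chartVec x v).1, chartIncl x.2 (chartVec x v).2) := by
  have hD {m : ℕ} (z : S m) (u : EuclideanSpace ℝ (Fin (2 * m + 1))) :
      stereoInvDeriv z 0 u = chartIncl z u := by
    rw [stereoInvDeriv_apply]; simp [stereoFactor]
  have h0 : extChartAt (model n p) x x = 0 := extChartAt_product_self x
  have h1 : HasFDerivAt (fun y => (stereoInv x.1 y.1, stereoInv x.2 y.2))
      (((stereoInvDeriv x.1 (extChartAt (model n p) x x).1).comp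
        (ContinuousLinearMap.fst ℝ _ _)).prod
        ((stereoInvDeriv x.2 (extChartAt (model n p) x x).2).comp (ContinuousLinearMap.snd ℝ _ _)))
      (extChartAt (model n p) x x) :=
    ((hasFDerivAt_stereoInv x.1 _).comp _ hasFDerivAt_fst).prodMk
      ((hasFDerivAt_stereoInv x.2 _).comp _ hasFDerivAt_snd)
  have h2 := h1.hasMFDerivAt.comp x
    (mdifferentiableAt_extChartAt (I := model n p) (mem_chart_source _ x)).hasMFDerivAt
  have h3 : incl n p =ᶠ[nhds x]
      (fun y => (stereoInv x.1 y.1, stereoInv x.2 y.2)) ∘ extChartAt (model n p) x := by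
    filter_upwards [extChartAt_source_mem_nhds (I := model n p) x] with z hz
    have h := incl_extChartAt_symm x (extChartAt (model n p) x z)
    rw [(extChartAt (model n p) x).left_inv hz] at h
    exact h
  have h4 := (h2.congr_of_eventuallyEq h3).mfderiv
  refine (congrArg (fun L => L v) h4).trans ?_
  rw [← hD, ← hD]
  rw [h0]
  rfl

theorem inner_chartVec_tangent (k : G n p) (A B : LieU (n + 1) × LieU (p + 1)) :
    inner ℝ (chartVec (point k) (tangent k A)).1 (chartVec (point k) (tangent k B)).1 =
        (inner ℂ (firstCol A.1.1) (firstCol B.1.1)).re ∧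
      inner ℝ (chartVec (point k) (tangent k A)).2 (chartVec (point k) (tangent k B)).2 =
        (inner ℂ (firstCol A.2.1) (firstCol B.2.1)).re := by
  have hA := (mvfderiv_incl_eq _ _).symm.trans (mvfderiv_incl_tangent k A)
  have hB := (mvfderiv_incl_eq _ _).symm.trans (mvfderiv_incl_tangent k B)
  rw [Prod.mk.injEq] at hA hB
  constructor
  · rw [← (chartIncl (point k).1).inner_map_map, hA.1, hB.1, inner_real_eq_re, inner_firstCol_mul]
  · rw [← (chartIncl (point k).2).inner_map_map, hA.2, hB.2, inner_real_eq_re, inner_firstCol_mul]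

theorem inner_hopfVec_tangent (k : G n p) (A : LieU (n + 1) × LieU (p + 1)) :
    inner ℝ (hopfVec (point k).1) (chartVec (point k) (tangent k A)).1 =
        (firstCol A.1.1 0).im ∧
      inner ℝ (hopfVec (point k).2) (chartVec (point k) (tangent k A)).2 =
        (firstCol A.2.1 0).im := by
  have hA := (mvfderiv_incl_eq _ _).symm.trans (mvfderiv_incl_tangent k A)
  rw [Prod.mk.injEq] at hA
  have h {m : ℕ} (k : Matrix.unitaryGroup (Fin (m + 1)) ℂ)
      (B : Matrix (Fin (m + 1)) (Fin (m + 1)) ℂ) :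
      vert (orbit k : Cn m) (firstCol (k.1 * B)) = (firstCol B 0).im := by
    have h1 : (orbit k : Cn m) = firstCol (k.1 * 1) := by
      rw [Matrix.mul_one]; rfl
    have h2 : firstCol (1 : Matrix (Fin (m + 1)) (Fin (m + 1)) ℂ) =
        EuclideanSpace.single 0 1 := by
      ext i
      simp [firstCol_apply, Matrix.one_apply]
    rw [vert_apply, h1, inner_firstCol_mul, h2, EuclideanSpace.inner_single_left]
    simp
  rw [inner_hopfVec, inner_hopfVec, hA.1, hA.2]
  exact ⟨h k.1 A.1.1, h k.2 A.2.1⟩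

end SphereProduct

/-! ### The matrix of the Ricci tensor and its eigenvalues -/

namespace SphereProduct

variable {n p : ℕ}

theorem firstCol_Xvec : firstCol (Xvec n).1 = EuclideanSpace.single 0 Complex.I := by
  have h : (Xvec n).1 = (1 / 2 : ℝ) • Complex.I • Tmat (0 : Fin (n + 1)) 0 := rfl
  ext i
  rw [firstCol_apply, h]
  rcases eq_or_ne i 0 with rfl | hi
  · simp [Tmat]; ring
  · simp [Tmat, hi, hi.symm]

theorem firstCol_Yvec (j : Fin n × Fin 2) : firstCol (Yvec n j).1 =
    EuclideanSpace.single j.1.succ (if j.2 = 0 then 1 else Complex.I) := by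
  ext i
  rw [firstCol_apply]
  rcases eq_or_ne i j.1.succ with rfl | hi
  · by_cases h : j.2 = 0 <;> simp [Yvec, h, Zmat, Tmat]
  · by_cases h : j.2 = 0 <;> simp [Yvec, h, Zmat, Tmat, hi, hi.symm]

theorem firstCol_Yvec_zero (j : Fin n × Fin 2) : firstCol (Yvec n j).1 0 = 0 := by
  simp [firstCol_Yvec]

theorem firstCol_Xvec_zero : firstCol (Xvec n).1 0 = Complex.I := by
  simp [firstCol_Xvec]

theorem inner_Xvec_Xvec : (inner ℂ (firstCol (Xvec n).1) (firstCol (Xvec n).1)).re = 1 := by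
  simp [firstCol_Xvec]

theorem inner_Xvec_Yvec (j : Fin n × Fin 2) :
    (inner ℂ (firstCol (Xvec n).1) (firstCol (Yvec n j).1)).re = 0 := by
  simp [firstCol_Xvec, firstCol_Yvec, EuclideanSpace.inner_single_left]

theorem inner_Yvec_Xvec (j : Fin n × Fin 2) :
    (inner ℂ (firstCol (Yvec n j).1) (firstCol (Xvec n).1)).re = 0 := by
  simp [firstCol_Xvec, firstCol_Yvec, EuclideanSpace.inner_single_left]

theorem inner_Yvec_Yvec (i j : Fin n × Fin 2) :
    (inner ℂ (firstCol (Yvec n i).1) (firstCol (Yvec n j).1)).re = if i = j then 1 else 0 := by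
  obtain ⟨i, s⟩ := i
  obtain ⟨j, t⟩ := j
  rcases eq_or_ne i j with rfl | h
  · fin_cases s <;> fin_cases t <;>
      simp [firstCol_Yvec, EuclideanSpace.inner_single_left]
  · simp [firstCol_Yvec, EuclideanSpace.inner_single_left, h]

theorem firstCol_zero : firstCol (0 : Matrix (Fin (n + 1)) (Fin (n + 1)) ℂ) = 0 := by
  ext i; simp [firstCol_apply]

/-- The Ricci tensor in the invariant frame. -/
theorem ricMatrix_eq (a c : ℝ) (hc : c ≠ 0) (k : G n p) :
    ricMatrix a c k = Matrix.fromBlocks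
      !![2 * ((n + p * a ^ 2) / c ^ 2), -2 * (a / c ^ 2) * (n + p * (a ^ 2 + c ^ 2));
        -2 * (a / c ^ 2) * (n + p * (a ^ 2 + c ^ 2)),
        2 * ((n * a ^ 2 + p * (a ^ 2 + c ^ 2) ^ 2) / c ^ 2)] 0 0
      (Matrix.diagonal (Sum.elim (fun _ => 2 * (1 + n - 1 / c))
        fun _ => 2 * (1 + p - (a ^ 2 + c ^ 2) / c))) := by
  ext i j
  rw [ricMatrix, Matrix.of_apply, Ric_eq a c hc]
  have hi := inner_hopfVec_tangent k (basisVec i)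
  have hj := inner_hopfVec_tangent k (basisVec j)
  have hij := inner_chartVec_tangent k (basisVec i) (basisVec j)
  simp only [HopfModel.ricciExplicit, HopfModel.hor₁, HopfModel.hor₂, hopfModel, frame, hi, hj,
    hij, finrank_euclideanSpace, Fintype.card_fin]
  clear hi hj hij
  rcases i with i | i | i <;> rcases j with j | j | j <;> (try fin_cases i) <;> (try fin_cases j)
  all_goals
    simp [basisVec, firstCol_zero, inner_Xvec_Xvec, inner_Yvec_Yvec, inner_Xvec_Yvec,
      inner_Yvec_Xvec, firstCol_Xvec_zero, firstCol_Yvec_zero, Matrix.diagonal_apply,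
      -inner_self_eq_norm_sq_to_K]
  all_goals (try split_ifs) <;> field_simp <;> ring

theorem roots_charpoly_fin_two (x y z : ℝ) :
    (!![x, z; z, y] : Matrix (Fin 2) (Fin 2) ℝ).charpoly.roots =
      {(x + y + Real.sqrt ((x - y) ^ 2 + 4 * z ^ 2)) / 2,
        (x + y - Real.sqrt ((x - y) ^ 2 + 4 * z ^ 2)) / 2} := by
  have hs := Real.sq_sqrt (show 0 ≤ (x - y) ^ 2 + 4 * z ^ 2 by positivity)
  set r := Real.sqrt ((x - y) ^ 2 + 4 * z ^ 2)
  have h : (!![x, z; z, y] : Matrix (Fin 2) (Fin 2) ℝ).charpoly =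
      (Polynomial.X - Polynomial.C ((x + y + r) / 2)) *
        (Polynomial.X - Polynomial.C ((x + y - r) / 2)) := by
    have h1 : x * y - z * z = ((x + y + r) / 2) * ((x + y - r) / 2) := by
      linear_combination (1 / 4) * hs
    have h2 : x + y = (x + y + r) / 2 + (x + y - r) / 2 := by ring
    rw [Matrix.charpoly_fin_two, Matrix.trace_fin_two_of, Matrix.det_fin_two_of, h1]
    nth_rw 1 [h2]
    rw [Polynomial.C_add, Polynomial.C_mul]
    ring
  rw [h, Polynomial.roots_mul (mul_ne_zero (Polynomial.X_sub_C_ne_zero _)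
    (Polynomial.X_sub_C_ne_zero _)), Polynomial.roots_X_sub_C, Polynomial.roots_X_sub_C]
  rfl

theorem roots_charpoly_diagonal {ι κ : Type*} [Fintype ι] [Fintype κ] [DecidableEq ι]
    [DecidableEq κ] (r s : ℝ) :
    (Matrix.diagonal (Sum.elim (fun _ : ι => r) fun _ : κ => s)).charpoly.roots =
      Multiset.replicate (Fintype.card ι) r + Multiset.replicate (Fintype.card κ) s := by
  have h : (Matrix.diagonal (Sum.elim (fun _ : ι => r) fun _ : κ => s)).charpoly =
      (Polynomial.X - Polynomial.C r) ^ Fintype.card ι *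
        (Polynomial.X - Polynomial.C s) ^ Fintype.card κ := by
    rw [Matrix.charpoly_diagonal, Fintype.prod_sum_type]
    simp
  rw [h, Polynomial.roots_mul (mul_ne_zero (pow_ne_zero _ (Polynomial.X_sub_C_ne_zero _))
    (pow_ne_zero _ (Polynomial.X_sub_C_ne_zero _))), Polynomial.roots_pow, Polynomial.roots_pow,
    Polynomial.roots_X_sub_C, Polynomial.roots_X_sub_C, Multiset.nsmul_singleton,
    Multiset.nsmul_singleton]

end SphereProduct

end

theorem proposition3 (n p : ℕ) (hnp : ¬(n = 0 ∧ p = 0)) (a c : ℝ) (hc : 0 < c) :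
    -- the Ricci tensor in the invariant frame, at every point `k · o`
    (∀ k : SphereProduct.G n p,
      SphereProduct.Ric n p a c (SphereProduct.point k)
          (SphereProduct.frame k SphereProduct.iX1) (SphereProduct.frame k SphereProduct.iX1) =
        2 * ((n + p * a ^ 2) / c ^ 2) ∧
      SphereProduct.Ric n p a c (SphereProduct.point k)
          (SphereProduct.frame k SphereProduct.iX2) (SphereProduct.frame k SphereProduct.iX2) =
        2 * ((n * a ^ 2 + p * (a ^ 2 + c ^ 2) ^ 2) / c ^ 2) ∧
      SphereProduct.Ric n p a c (SphereProduct.point k)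
          (SphereProduct.frame k SphereProduct.iX1) (SphereProduct.frame k SphereProduct.iX2) =
        -2 * (a / c ^ 2) * (n + p * (a ^ 2 + c ^ 2)) ∧
      SphereProduct.Ric n p a c (SphereProduct.point k)
          (SphereProduct.frame k SphereProduct.iX2) (SphereProduct.frame k SphereProduct.iX1) =
        -2 * (a / c ^ 2) * (n + p * (a ^ 2 + c ^ 2)) ∧
      (∀ j : Fin n × Fin 2,
        SphereProduct.Ric n p a c (SphereProduct.point k)
            (SphereProduct.frame k (SphereProduct.iY1 j))
            (SphereProduct.frame k (SphereProduct.iY1 j)) =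
          2 * (1 + n - 1 / c)) ∧
      (∀ j : Fin p × Fin 2,
        SphereProduct.Ric n p a c (SphereProduct.point k)
            (SphereProduct.frame k (SphereProduct.iY2 j))
            (SphereProduct.frame k (SphereProduct.iY2 j)) =
          2 * (1 + p - (a ^ 2 + c ^ 2) / c)) ∧
      (∀ i j : SphereProduct.Idx n p, i ≠ j →
        ¬(i = SphereProduct.iX1 ∧ j = SphereProduct.iX2) →
        ¬(i = SphereProduct.iX2 ∧ j = SphereProduct.iX1) →
        SphereProduct.Ric n p a c (SphereProduct.point k)
          (SphereProduct.frame k i) (SphereProduct.frame k j) = 0)) ∧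
    -- the eigenvalues, with multiplicity, of the matrix of the Ricci tensor in this frame
    (∀ x y z : ℝ, x = 2 * ((n + p * a ^ 2) / c ^ 2) →
      y = 2 * ((n * a ^ 2 + p * (a ^ 2 + c ^ 2) ^ 2) / c ^ 2) →
      z = -2 * (a / c ^ 2) * (n + p * (a ^ 2 + c ^ 2)) →
      ∀ k : SphereProduct.G n p,
        (SphereProduct.ricMatrix a c k).charpoly.roots =
          {(x + y + Real.sqrt ((x - y) ^ 2 + 4 * z ^ 2)) / 2,
            (x + y - Real.sqrt ((x - y) ^ 2 + 4 * z ^ 2)) / 2} +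
          Multiset.replicate (2 * n) (2 * (1 + n - 1 / c)) +
          Multiset.replicate (2 * p) (2 * (1 + p - (a ^ 2 + c ^ 2) / c))) ∧
    -- the scalar curvature, at every point
    (∀ q : SphereProduct.S n × SphereProduct.S p,
      SphereProduct.scal n p a c q =
        4 * n * (1 + n - 1 / (2 * c)) + 4 * p * (1 + p - (a ^ 2 + c ^ 2) / (2 * c))) := by
  have hR (k : SphereProduct.G n p) (i j : SphereProduct.Idx n p) :
      SphereProduct.Ric n p a c (SphereProduct.point k) (SphereProduct.frame k i)
        (SphereProduct.frame k j) = _ :=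
    congrFun (congrFun (SphereProduct.ricMatrix_eq a c hc.ne' k) i) j
  refine ⟨fun k => ⟨hR k _ _, hR k _ _, hR k _ _, hR k _ _, fun j => ?_, fun j => ?_,
    fun i j hij h1 h2 => ?_⟩, ?_, SphereProduct.scal_eq a c hc.ne'⟩
  · rw [hR]; simp
  · rw [hR]; simp
  · rw [hR]
    rcases i with i | i <;> rcases j with j | j
    · fin_cases i <;> fin_cases j <;> simp_all
    · rfl
    · rfl
    · exact Matrix.diagonal_apply_ne _ fun h => hij (congrArg Sum.inr h)
  · rintro x y z rfl rfl rfl k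
    rw [SphereProduct.ricMatrix_eq a c hc.ne' k, Matrix.charpoly_fromBlocks_zero₁₂,
      Polynomial.roots_mul (mul_ne_zero (Matrix.charpoly_monic _).ne_zero
        (Matrix.charpoly_monic _).ne_zero), SphereProduct.roots_charpoly_fin_two,
      SphereProduct.roots_charpoly_diagonal, add_assoc]
    simp [mul_comm]
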